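/- There are absolute constants $C>0$ and $p\in\mathbb N$ such that the following holds. Setting. $N\ge 2$ agents are the vertices of a connected graph $G$ with diameter $D$ and maximum degree $K_G$, and all of them face the same stochastic bandit with $K\ge 1$ arms, means $\mu_i\in[0,1]$, over a horizon of $T$ steps. If agent $n$ plays arm $i_n(t)$ at time $t$, it receives the reward $\mu_{i_n(t)}+\eta_{n,t}$, where $\eta_{n,t}$ is $1$-sub-Gaussian given the past (everything that happened before the rewards of time $t$ are drawn, including the plays at time $t$): $\mathbb E[e^{\lambda\eta_{n,t}}\mid \text{past}]\le e^{\lambda^2/2}$ for all $\lambda\in\mathbb R$. Put $K'=\lceil K/N\rceil+K_G$. Algorithm (LCC-UCB on $G$). Agent $n\in\{1,\dots,N\}$ owns the set $\mathcal S_n$ of the $\lceil K/N\rceil$ cyclically consecutive arms $((n-1)\lceil K/N\rceil \bmod K)+1,\dots,((n\lceil K/N\rceil-1)\bmod K)+1$. Time is divided into epochs $j=0,1,2,\dots$ of lengths $K'(K'+1)2^j$, the last one being cut off at the horizon. In epoch $j$ agent $n$ restarts UCB on the set $\mathcal A_{n,j}$, where $\mathcal A_{n,0}=\mathcal S_n$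 and, for $j\ge1$, $\mathcal A_{n,j}$ consists of $\mathcal S_n$ and of the arms that the neighbours of $n$ in $G$ sent at the end of epoch $j-1$. At step $\tau$ of an epoch, UCB plays an arm $i\in\mathcal A_{n,j}$ that maximizes $\hat\mu_i+\sqrt{2\log\tau/N_i}$, where $N_i$ and $\hat\mu_i$ are the number of plays and the empirical mean reward of arm $i$ so far in this epoch (the index is $\infty$ if $N_i=0$). At the end of each completed epoch every agent sends an arm of $\mathcal A_{n,j}$ that it played most often in that epoch to its neighbours. Ties are broken arbitrarily, without knowledge of the future. Claim. The regret $R_n(T)=T\max_i\mu_i-\mathbb E\big[\sum_{t=1}^T\mu_{i_n(t)}\big]$ of every agent $n$ satisfies, for every horizon $T\ge 1$, $$R_n(T)\le C\,(1+\log T)^p\Big(2^D K'^2+\sqrt{D\,2^D K'\,T}\Big),$$ that is, $R_n(T)\le\tilde O\big(2^DK'^2+\sqrt{D2^DK'T}\big)$. -/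

import Mathlib

open MeasureTheory

noncomputable section

namespace LCCUCB

/-! Arms are indexed by `Fin K`, agents by `Fin N`, and time by `t = 0, 1, …` (so play number `t + 1`
takes place at time `t`). -/

/-- Number of arms initially allotted to every agent, `⌈K / N⌉`. -/
def armsPerAgent (N K : ℕ) : ℕ := ⌈(K : ℚ) / (N : ℚ)⌉₊

/-- Initial arm set `S_n` of agent `n`: the `⌈K / N⌉` cyclically consecutive arms starting
at `n ⌈K / N⌉ mod K` (agents and arms are numbered from `0`). -/
def initialArms (N K : ℕ) (n : Fin N) : Finset (Fin K) :=
  Finset.univ.filter fun i =>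
    ∃ k ∈ Finset.range (armsPerAgent N K), (i : ℕ) = ((n : ℕ) * armsPerAgent N K + k) % K

/-- `K' = ⌈K / N⌉ + K_G`, with `K_G` the maximum degree of the communication graph. -/
def effArms {N : ℕ} (K : ℕ) (G : SimpleGraph (Fin N)) [DecidableRel G.Adj] : ℕ :=
  armsPerAgent N K + G.maxDegree

/-- Length `K' (K' + 1) 2 ^ j` of epoch `j`. -/
def epochLength (K' j : ℕ) : ℕ := K' * (K' + 1) * 2 ^ j

/-- First time step of epoch `j`; epoch `j` consists of the times in
`[epochStart K' j, epochStart K' (j + 1))`. -/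
def epochStart (K' j : ℕ) : ℕ := ∑ i ∈ Finset.range j, epochLength K' i

/-! ### The UCB subroutine, started at time `s` -/

/-- Number of plays of arm `i` at the times `s ≤ u < t`, for a sequence of plays `a`. -/
def playCount {K : ℕ} (a : ℕ → Fin K) (s t : ℕ) (i : Fin K) : ℕ :=
  ((Finset.Ico s t).filter fun u => a u = i).card

/-- Empirical mean of the rewards `r` obtained from arm `i` at the times `s ≤ u < t`. -/
def empMean {K : ℕ} (a : ℕ → Fin K) (r : ℕ → ℝ) (s t : ℕ) (i : Fin K) : ℝ :=
  (∑ u ∈ (Finset.Ico s t).filter (fun u => a u = i), r u) / (playCount a s t i : ℝ)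

/-- UCB index of arm `i` at time `t`, which is step `t_j = t - s + 1` of the subroutine:
`∞` if the arm has not been played since time `s`, and otherwise
`empirical mean + √(2 log t_j / number of plays)`. -/
def ucbIndex {K : ℕ} (a : ℕ → Fin K) (r : ℕ → ℝ) (s t : ℕ) (i : Fin K) : EReal :=
  if playCount a s t i = 0 then ⊤
  else ((empMean a r s t i +
    Real.sqrt (2 * Real.log ((t : ℝ) - (s : ℝ) + 1) / (playCount a s t i : ℝ)) : ℝ) : EReal)

/-- At time `t`, the play `a t` maximizes the UCB index over the arm set `A`
(ties are broken arbitrarily). -/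
def IsUCBPlay {K : ℕ} (A : Finset (Fin K)) (a : ℕ → Fin K) (r : ℕ → ℝ) (s t : ℕ) : Prop :=
  a t ∈ A ∧ ∀ i ∈ A, ucbIndex a r s t i ≤ ucbIndex a r s t (a t)

/-- `i` is a most played arm of `A` during the times `s ≤ u < e` (ties are broken arbitrarily). -/
def IsMostPlayed {K : ℕ} (A : Finset (Fin K)) (a : ℕ → Fin K) (s e : ℕ) (i : Fin K) : Prop :=
  i ∈ A ∧ ∀ i' ∈ A, playCount a s e i' ≤ playCount a s e i

/-! ### The algorithm on a graph -/

/-- Augmented arm set `A_{n,j}` of agent `n` in epoch `j`, where `msg m j` is the arm that agent `m`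
sends to its neighbours at the end of epoch `j`. Older recommendations are purged. -/
def augmentedArms {N K : ℕ} (G : SimpleGraph (Fin N)) [DecidableRel G.Adj]
    (msg : Fin N → ℕ → Fin K) (n : Fin N) : ℕ → Finset (Fin K)
  | 0 => initialArms N K n
  | j + 1 => initialArms N K n ∪ (G.neighborFinset n).image fun m => msg m j

/-- The plays `arm n t`, the rewards `rew n t` (`t < T`) and the messages `msg n j` form a run with
horizon `T` of plain LCC-UCB in which agents talk to their graph neighbours only: in every epoch each
agent restarts UCB on its augmented arm set (the last epoch is cut off at the horizon), and
after every completed epoch it sends its most played arm to its neighbours. -/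
structure IsRun {N K : ℕ} (G : SimpleGraph (Fin N)) [DecidableRel G.Adj] (T : ℕ)
    (arm : Fin N → ℕ → Fin K) (rew : Fin N → ℕ → ℝ) (msg : Fin N → ℕ → Fin K) : Prop where
  play : ∀ (n : Fin N) (j t : ℕ), epochStart (effArms K G) j ≤ t →
    t < epochStart (effArms K G) (j + 1) → t < T →
    IsUCBPlay (augmentedArms G msg n j) (arm n) (rew n) (epochStart (effArms K G) j) t
  send : ∀ (n : Fin N) (j : ℕ), epochStart (effArms K G) (j + 1) ≤ T →
    IsMostPlayed (augmentedArms G msg n j) (arm n) (epochStart (effArms K G) j)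
      (epochStart (effArms K G) (j + 1)) (msg n j)

/-- Plain LCC-UCB with horizon `T` on the graph `G`, in the stochastic bandit with arm means `μ` and
noise `η`: playing `arm n t` at time `t` gives agent `n` the reward `μ (arm n t) + η n t`.
`ℱ t` is the information available just before the rewards of time `t` are drawn. -/
structure IsLCCUCB {N K : ℕ} {Ω : Type*} {mΩ : MeasurableSpace Ω} (P : Measure Ω)
    (ℱ : Filtration ℕ mΩ) (G : SimpleGraph (Fin N)) [DecidableRel G.Adj] (T : ℕ) (μ : Fin K → ℝ)
    (η : Fin N → ℕ → Ω → ℝ) (arm msg : Fin N → ℕ → Ω → Fin K) : Prop where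
  /-- plays do not depend on the present or future noise -/
  arm_measurable : ∀ n, ∀ t < T, Measurable[ℱ t] (arm n t)
  /-- neither do the messages -/
  msg_measurable : ∀ n j, epochStart (effArms K G) (j + 1) ≤ T →
    Measurable[ℱ (epochStart (effArms K G) (j + 1))] (msg n j)
  noise_measurable : ∀ n, ∀ t < T, Measurable[ℱ (t + 1)] (η n t)
  /-- the noise is 1-sub-Gaussian, given the past -/
  noise_integrable : ∀ n, ∀ t < T, ∀ l : ℝ, Integrable (fun ω => Real.exp (l * η n t ω)) P
  noise_subGaussian : ∀ n, ∀ t < T, ∀ l : ℝ,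
    P[fun ω => Real.exp (l * η n t ω) | ℱ t] ≤ᵐ[P] fun _ => Real.exp (l ^ 2 / 2)
  run : ∀ ω, IsRun G T (fun n t => arm n t ω) (fun n t => μ (arm n t ω) + η n t ω)
    (fun n j => msg n j ω)

/-- Cumulative regret `T · max_i μ_i - 𝔼 [∑_{t < T} μ (a t)]` of an agent with plays `a`. -/
def regret {K : ℕ} {Ω : Type*} [MeasurableSpace Ω] (P : Measure Ω) (μ : Fin K → ℝ) (T : ℕ)
    (a : ℕ → Ω → Fin K) : ℝ :=
  (T : ℝ) * (⨆ i, μ i) - ∫ ω, ∑ t ∈ Finset.range T, μ (a t ω) ∂P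

end LCCUCB

end

/-! Write `Λ = 1 + log T` and `K'` for `effArms`. The owner of a best arm always has it in its arm
set, and knowledge of a good arm travels one edge per epoch. At distance `d` from the owner, an
agent in epoch `j` therefore profits from what the owner learned in epoch `j - d`, which is `2 ^ d`
times shorter; this is the source of `2 ^ D`. One hop is `IsMostPlayed.gap_le`: an epoch has `K' (K'
+ 1) 2 ^ j` steps and at most `K'` arms, so a most played arm has at least `q = (K' + 1) 2 ^ j`
plays and is worse than the best arm of the set by at most about `Λ / √q` plus `(number of
deviations) / q`. Adding these losses along a shortest walk to the owner gives geometric sums,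
summed up in `gapBound` (`IsLCCUCB.integral_armSetGap_le`). The regret in an epoch is its length
times the gap of the arm set, plus the usual UCB regret inside the set (`sum_gap_le`). Each epoch
costs `O(Λ ^ 3)` times the claimed bound, and there are `O(Λ)` epochs. All UCB estimates are
pathwise: failures of confidence intervals enter only through the count `deviations`. Its
expectation over an epoch is `O(Λ ^ 3 K')`, by a Chernoff bound uniform in the random number of
plays (`SubGaussianPlays.measureReal_deviates_le`). -/

noncomputable section

namespace LCCUCB

/-! ### Pathwise analysis of one UCB epoch -/

section UCB

variable {K : ℕ}

/-- Sum of the noise `x` collected from arm `i` at the times `s ≤ u < t`. -/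
def noiseSum (a : ℕ → Fin K) (x : ℕ → ℝ) (s t : ℕ) (i : Fin K) : ℝ :=
  ∑ u ∈ (Finset.Ico s t).filter (fun u => a u = i), x u

/-- The empirical mean of arm `i` at time `t` leaves its confidence interval. -/
def Deviates (a : ℕ → Fin K) (x : ℕ → ℝ) (s t : ℕ) (i : Fin K) : Prop :=
  playCount a s t i ≠ 0 ∧
    Real.sqrt (2 * Real.log ((t : ℝ) - (s : ℝ) + 1) * (playCount a s t i : ℝ)) <
      |noiseSum a x s t i|

open Classical in
/-- Number of arms of `A` that deviate at time `t`. -/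
def deviations (A : Finset (Fin K)) (a : ℕ → Fin K) (x : ℕ → ℝ) (s t : ℕ) : ℝ :=
  ∑ i, if i ∈ A ∧ Deviates a x s t i then (1 : ℝ) else 0

/-- Bound on the instantaneous regret of an arm that was played `k` times before. -/
def playLoss (β : ℝ) (k : ℕ) : ℝ := if k = 0 then 1 else 2 * β / Real.sqrt k

lemma playCount_succ (a : ℕ → Fin K) {s t : ℕ} (h : s ≤ t) (i : Fin K) :
    playCount a s (t + 1) i = playCount a s t i + if a t = i then 1 else 0 := by
  unfold playCount
  rw [← Finset.insert_Ico_right_eq_Ico_add_one h, Finset.filter_insert]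
  split_ifs with hi
  · rw [Finset.card_insert_of_notMem (by simp)]
  · rfl

lemma noiseSum_succ (a : ℕ → Fin K) (x : ℕ → ℝ) {s t : ℕ} (h : s ≤ t) (i : Fin K) :
    noiseSum a x s (t + 1) i = noiseSum a x s t i + if a t = i then x t else 0 := by
  unfold noiseSum
  rw [← Finset.insert_Ico_right_eq_Ico_add_one h, Finset.filter_insert]
  split_ifs with hi
  · rw [Finset.sum_insert (by simp), add_comm]
  · simp

lemma playCount_self (a : ℕ → Fin K) (s : ℕ) (i : Fin K) : playCount a s s i = 0 := by
  simp [playCount]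

lemma noiseSum_self (a : ℕ → Fin K) (x : ℕ → ℝ) (s : ℕ) (i : Fin K) :
    noiseSum a x s s i = 0 := by
  simp [noiseSum]

lemma playCount_le (a : ℕ → Fin K) (s t : ℕ) (i : Fin K) : playCount a s t i ≤ t - s := by
  unfold playCount
  exact (Finset.card_filter_le _ _).trans (by simp)

lemma empMean_eq {μ : Fin K → ℝ} {a : ℕ → Fin K} {x : ℕ → ℝ} {s t : ℕ} {i : Fin K}
    (h : playCount a s t i ≠ 0) :
    empMean a (fun u => μ (a u) + x u) s t i
      = μ i + noiseSum a x s t i / (playCount a s t i : ℝ) := by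
  have h0 : (playCount a s t i : ℝ) ≠ 0 := by exact_mod_cast h
  unfold empMean noiseSum
  rw [Finset.sum_add_distrib, add_div]
  congr 1
  rw [div_eq_iff h0, Finset.sum_congr rfl (g := fun _ => μ i)
    (fun u hu => by rw [(Finset.mem_filter.1 hu).2]), Finset.sum_const, nsmul_eq_mul, mul_comm]
  rfl

lemma deviations_nonneg (A : Finset (Fin K)) (a : ℕ → Fin K) (x : ℕ → ℝ) (s t : ℕ) :
    0 ≤ deviations A a x s t :=
  Finset.sum_nonneg fun i _ => by split_ifs <;> norm_num

/-- Instantaneous regret is at most 1, so the deviation count pays for every step at which a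
confidence interval fails, and no good event has to be fixed. -/
lemma one_le_deviations {A : Finset (Fin K)} {a : ℕ → Fin K} {x : ℕ → ℝ} {s t : ℕ} {i : Fin K}
    (hi : i ∈ A) (h : Deviates a x s t i) : 1 ≤ deviations A a x s t := by
  classical
  refine le_trans ?_ (Finset.single_le_sum
    (f := fun i => if i ∈ A ∧ Deviates a x s t i then (1 : ℝ) else 0)
    (fun i _ => by split_ifs <;> norm_num) (Finset.mem_univ i))
  simp [hi, h]

lemma abs_noiseSum_div_le {a : ℕ → Fin K} {x : ℕ → ℝ} {s t : ℕ} {i : Fin K}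
    (h : playCount a s t i ≠ 0) (hd : ¬ Deviates a x s t i) :
    |noiseSum a x s t i / (playCount a s t i : ℝ)|
      ≤ Real.sqrt (2 * Real.log ((t : ℝ) - (s : ℝ) + 1) / (playCount a s t i : ℝ)) := by
  have hN : (0 : ℝ) < playCount a s t i := by exact_mod_cast Nat.pos_of_ne_zero h
  have hd' := not_lt.1 (fun hlt => hd ⟨h, hlt⟩)
  rw [abs_div, abs_of_pos hN, div_le_iff₀ hN]
  refine hd'.trans (le_of_eq ?_)
  rw [show 2 * Real.log ((t : ℝ) - (s : ℝ) + 1) * (playCount a s t i : ℝ)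
    = 2 * Real.log ((t : ℝ) - (s : ℝ) + 1) / (playCount a s t i : ℝ)
      * (playCount a s t i : ℝ) ^ 2 by field_simp, Real.sqrt_mul' _ (by positivity),
    Real.sqrt_sq hN.le]

/-- Regret of a single UCB play. -/
lemma IsUCBPlay.gap_le {μ : Fin K → ℝ} (hμ : ∀ i, 0 ≤ μ i ∧ μ i ≤ 1) {A : Finset (Fin K)}
    {a : ℕ → Fin K} {x : ℕ → ℝ} {s t : ℕ} {β : ℝ} (hβ0 : 0 ≤ β)
    (hβ : Real.sqrt (2 * Real.log ((t : ℝ) - (s : ℝ) + 1)) ≤ β)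
    (h : IsUCBPlay A a (fun u => μ (a u) + x u) s t) {i : Fin K} (hi : i ∈ A) :
    μ i - μ (a t) ≤ playLoss β (playCount a s t (a t)) + deviations A a x s t := by
  have hdn := deviations_nonneg A a x s t
  have h1 : μ i - μ (a t) ≤ 1 := by linarith [(hμ i).2, (hμ (a t)).1]
  have hl0 : 0 ≤ playLoss β (playCount a s t (a t)) := by
    unfold playLoss; split_ifs <;> positivity
  by_cases hdi : Deviates a x s t i
  · linarith [one_le_deviations hi hdi]
  by_cases hda : Deviates a x s t (a t)
  · linarith [one_le_deviations h.1 hda]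
  by_cases hN : playCount a s t (a t) = 0
  · rw [playLoss, if_pos hN]; linarith
  have hle := h.2 i hi
  -- An unplayed `i` has index `⊤` and would beat the arm `a t`, whose index is finite.
  by_cases hNi : playCount a s t i = 0
  · simp only [ucbIndex, if_pos hNi, if_neg hN, top_le_iff] at hle
    exact absurd hle (EReal.coe_ne_top _)
  simp only [ucbIndex, if_neg hNi, if_neg hN, EReal.coe_le_coe_iff] at hle
  rw [empMean_eq hNi, empMean_eq hN] at hle
  have e1 := abs_le.1 (abs_noiseSum_div_le hNi hdi)
  have e2 := abs_le.1 (abs_noiseSum_div_le hN hda)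
  have hb : Real.sqrt (2 * Real.log ((t : ℝ) - (s : ℝ) + 1) / (playCount a s t (a t) : ℝ))
      ≤ β / Real.sqrt (playCount a s t (a t) : ℝ) := by
    rw [Real.sqrt_div' _ (Nat.cast_nonneg _)]
    gcongr
  rw [playLoss, if_neg hN, mul_div_assoc]
  linarith [e1.1, e2.2]

/-- The successive plays of one arm see the counts 0, 1, 2, …, so a sum over times turns into a sum
over counts. -/
lemma sum_filter_playCount (a : ℕ → Fin K) (f : ℕ → ℝ) {s e : ℕ} (h : s ≤ e) (i : Fin K) :
    ∑ t ∈ (Finset.Ico s e).filter (fun t => a t = i), f (playCount a s t (a t))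
      = ∑ k ∈ Finset.range (playCount a s e i), f k := by
  induction e, h using Nat.le_induction with
  | base => simp [playCount_self]
  | succ e he ih =>
    rw [playCount_succ a he, ← Finset.insert_Ico_right_eq_Ico_add_one he, Finset.filter_insert]
    split_ifs with hi
    · rw [Finset.sum_insert (by simp), ih, Finset.sum_range_succ, hi, add_comm]
    · simpa using ih

lemma sum_playLoss_succ_le {β : ℝ} (hβ : 0 ≤ β) (n : ℕ) :
    ∑ k ∈ Finset.range (n + 1), playLoss β k ≤ 1 + 4 * β * Real.sqrt n := by
  induction n with
  | zero => simp [playLoss]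
  | succ n ih =>
    rw [Finset.sum_range_succ, playLoss, if_neg n.succ_ne_zero]
    have hn : (0 : ℝ) < ((n + 1 : ℕ) : ℝ) := by positivity
    have hs := Real.sqrt_pos.2 hn
    have h1 := Real.sq_sqrt hn.le
    have h2 := Real.sq_sqrt (Nat.cast_nonneg (α := ℝ) n)
    push_cast at h1 hs ih ⊢
    -- This makes the sum telescope.
    have key : 2 * β / Real.sqrt (n + 1) ≤ 4 * β * (Real.sqrt (n + 1) - Real.sqrt n) := by
      rw [div_le_iff₀ hs]
      have : 1 ≤ 2 * (Real.sqrt (n + 1) - Real.sqrt n) * Real.sqrt (n + 1) := by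
        nlinarith [sq_nonneg (Real.sqrt (n + 1) - Real.sqrt n)]
      nlinarith
    linarith

lemma sum_playLoss_le {β : ℝ} (hβ : 0 ≤ β) (n : ℕ) :
    ∑ k ∈ Finset.range n, playLoss β k ≤ 1 + 4 * β * Real.sqrt n := by
  cases n with
  | zero => simp
  | succ n =>
    refine (sum_playLoss_succ_le hβ n).trans ?_
    gcongr
    simp

lemma sum_playCount {A : Finset (Fin K)} {a : ℕ → Fin K} {s e : ℕ}
    (ha : ∀ t ∈ Finset.Ico s e, a t ∈ A) : ∑ i ∈ A, playCount a s e i = e - s := by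
  rw [← Nat.card_Ico, Finset.card_eq_sum_card_fiberwise ha]
  rfl

section Epoch

variable {μ : Fin K → ℝ} (hμ : ∀ i, 0 ≤ μ i ∧ μ i ≤ 1) {A : Finset (Fin K)}
  {a : ℕ → Fin K} {x : ℕ → ℝ} {s e : ℕ} {β : ℝ} (hβ0 : 0 ≤ β)
  (hβ : ∀ t ∈ Finset.Ico s e, Real.sqrt (2 * Real.log ((t : ℝ) - (s : ℝ) + 1)) ≤ β)
  (h : ∀ t ∈ Finset.Ico s e, IsUCBPlay A a (fun u => μ (a u) + x u) s t)

include hμ hβ0 hβ h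

/-- Regret of one UCB epoch with respect to an arm of its arm set. -/
lemma sum_gap_le (hse : s ≤ e) {i : Fin K} (hi : i ∈ A) :
    ∑ t ∈ Finset.Ico s e, (μ i - μ (a t)) ≤
      A.card + 4 * β * Real.sqrt (A.card * ((e : ℝ) - s))
        + ∑ t ∈ Finset.Ico s e, deviations A a x s t := by
  have ha : ∀ t ∈ Finset.Ico s e, a t ∈ A := fun t ht => (h t ht).1
  calc ∑ t ∈ Finset.Ico s e, (μ i - μ (a t))
      ≤ ∑ t ∈ Finset.Ico s e, (playLoss β (playCount a s t (a t)) + deviations A a x s t) :=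
        Finset.sum_le_sum fun t ht => (h t ht).gap_le hμ hβ0 (hβ t ht) hi
    _ = ∑ j ∈ A, ∑ k ∈ Finset.range (playCount a s e j), playLoss β k
        + ∑ t ∈ Finset.Ico s e, deviations A a x s t := by
        rw [Finset.sum_add_distrib, ← Finset.sum_fiberwise_of_maps_to ha]
        congr 1
        exact Finset.sum_congr rfl fun j _ => sum_filter_playCount a _ hse j
    _ ≤ ∑ j ∈ A, (1 + 4 * β * Real.sqrt (playCount a s e j))
        + ∑ t ∈ Finset.Ico s e, deviations A a x s t := by
        gcongr with j _
        exact sum_playLoss_le hβ0 _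
    _ ≤ _ := by
        rw [Finset.sum_add_distrib, ← Finset.mul_sum, Finset.sum_const, nsmul_eq_mul, mul_one]
        gcongr
        -- Cauchy–Schwarz over the arms, whose play counts add up to the length of the epoch.
        apply Real.le_sqrt_of_sq_le
        refine sq_sum_le_card_mul_sum_sq.trans (le_of_eq ?_)
        rw [Finset.sum_congr rfl (fun j _ => Real.sq_sqrt (Nat.cast_nonneg _)),
          ← Nat.cast_sum, sum_playCount ha, Nat.cast_sub hse]

/-- A most played arm of a UCB epoch is almost as good as any other arm. -/
lemma IsMostPlayed.gap_le {q : ℝ} (hq : 0 < q) (hse : s ≤ e) (hqA : q * A.card ≤ (e : ℝ) - s)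
    {m : Fin K} (hm : IsMostPlayed A a s e m) {i : Fin K} (hi : i ∈ A) :
    μ i - μ m ≤ (1 + ∑ t ∈ Finset.Ico s e, deviations A a x s t) / q
      + 4 * β / Real.sqrt q := by
  have ha : ∀ t ∈ Finset.Ico s e, a t ∈ A := fun t ht => (h t ht).1
  have hD : 0 ≤ ∑ t ∈ Finset.Ico s e, deviations A a x s t :=
    Finset.sum_nonneg fun t _ => deviations_nonneg A a x s t
  have hA : (0 : ℝ) < A.card := by exact_mod_cast Finset.card_pos.2 ⟨i, hi⟩
  -- Pigeonhole: the most played arm gets at least the average number of plays.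
  have hqN : q ≤ playCount a s e m := by
    have h1 : e - s ≤ A.card * playCount a s e m := by
      rw [← sum_playCount ha, ← smul_eq_mul]
      exact Finset.sum_le_card_nsmul _ _ _ hm.2
    have h2 : (e : ℝ) - s ≤ A.card * playCount a s e m := by
      rw [← Nat.cast_sub hse]; exact_mod_cast h1
    nlinarith
  have hN : (0 : ℝ) < playCount a s e m := hq.trans_le hqN
  have hsN := Real.sqrt_pos.2 hN
  -- Only the plays of `m` itself are summed; each of them loses exactly `μ i - μ m`.
  have key : (playCount a s e m : ℝ) * (μ i - μ m) ≤
      1 + 4 * β * Real.sqrt (playCount a s e m)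
        + ∑ t ∈ Finset.Ico s e, deviations A a x s t := by
    calc (playCount a s e m : ℝ) * (μ i - μ m)
        = ∑ t ∈ (Finset.Ico s e).filter (fun t => a t = m), (μ i - μ (a t)) := by
          rw [Finset.sum_congr rfl (g := fun _ => μ i - μ m)
            (fun u hu => by rw [(Finset.mem_filter.1 hu).2]), Finset.sum_const, nsmul_eq_mul]
          rfl
      _ ≤ ∑ t ∈ (Finset.Ico s e).filter (fun t => a t = m),
            (playLoss β (playCount a s t (a t)) + deviations A a x s t) :=
          Finset.sum_le_sum fun t ht =>
            (h t (Finset.mem_filter.1 ht).1).gap_le hμ hβ0 (hβ t (Finset.mem_filter.1 ht).1) hi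
      _ ≤ _ := by
          rw [Finset.sum_add_distrib, sum_filter_playCount a _ hse]
          gcongr
          · exact sum_playLoss_le hβ0 _
          · exact fun t _ _ => deviations_nonneg A a x s t
          · exact Finset.filter_subset _ _
  calc μ i - μ m ≤ (1 + 4 * β * Real.sqrt (playCount a s e m)
        + ∑ t ∈ Finset.Ico s e, deviations A a x s t) / playCount a s e m := by
        rw [le_div_iff₀ hN]; linarith
    _ = (1 + ∑ t ∈ Finset.Ico s e, deviations A a x s t) / playCount a s e m
        + 4 * β / Real.sqrt (playCount a s e m) := by
        have := Real.sq_sqrt hN.le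
        have h3 : 4 * β * Real.sqrt (playCount a s e m) / (playCount a s e m : ℝ)
          = 4 * β / Real.sqrt (playCount a s e m) := by
          rw [div_eq_div_iff hN.ne' hsN.ne']; nlinarith
        rw [← h3]; ring
    _ ≤ _ := by gcongr

end Epoch

end UCB

/-! ### Deviation probabilities for a random number of plays -/

section Concentration

open scoped ENNReal

variable {K : ℕ}

/-- Pulling a bound on a conditional expectation out of a lower Lebesgue integral. -/
lemma lintegral_mul_ofReal_le_of_condExp_le {Ω : Type*} {m mΩ : MeasurableSpace Ω}
    {P : Measure Ω} [IsFiniteMeasure P] (hm : m ≤ mΩ) {f : Ω → ℝ≥0∞} (hf : Measurable[m] f)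
    {g : Ω → ℝ} (hg : Integrable g P) (hg0 : ∀ ω, 0 ≤ g ω) {c : ℝ}
    (hc : P[g | m] ≤ᵐ[P] fun _ => c) :
    ∫⁻ ω, ENNReal.ofReal (g ω) * f ω ∂P ≤ ENNReal.ofReal c * ∫⁻ ω, f ω ∂P := by
  -- Comparing the two measures on `m` avoids any integrability assumption on `f`.
  have hle : (P.withDensity fun ω => ENNReal.ofReal (g ω)).trim hm
      ≤ (ENNReal.ofReal c • P).trim hm := by
    refine Measure.le_iff.2 fun A hA => ?_
    rw [trim_measurableSet_eq hm hA, trim_measurableSet_eq hm hA, withDensity_apply _ (hm A hA),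
      ← ofReal_integral_eq_lintegral_ofReal hg.integrableOn (ae_of_all _ hg0),
      ← setIntegral_condExp hm hg hA, Measure.smul_apply, smul_eq_mul]
    by_cases hc0 : 0 ≤ c
    · rw [← ENNReal.ofReal_toReal (measure_ne_top P A), ← ENNReal.ofReal_mul hc0]
      apply ENNReal.ofReal_le_ofReal
      calc ∫ ω in A, (P[g | m]) ω ∂P ≤ ∫ _ in A, c ∂P :=
            setIntegral_mono_ae integrable_condExp.integrableOn (integrable_const _) hc
        _ = c * (P A).toReal := by rw [setIntegral_const, smul_eq_mul, mul_comm]; rfl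
    · refine le_of_eq_of_le (ENNReal.ofReal_of_nonpos ?_) zero_le
      calc ∫ ω in A, (P[g | m]) ω ∂P ≤ ∫ _ in A, c ∂P :=
            setIntegral_mono_ae integrable_condExp.integrableOn (integrable_const _) hc
        _ ≤ 0 := integral_nonpos fun _ => (not_le.1 hc0).le
  calc ∫⁻ ω, ENNReal.ofReal (g ω) * f ω ∂P
      = ∫⁻ ω, f ω ∂(P.withDensity fun ω => ENNReal.ofReal (g ω)) :=
        (lintegral_withDensity_eq_lintegral_mul₀ hg.1.aemeasurable.ennreal_ofReal
          (hf.mono hm le_rfl).aemeasurable).symm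
    _ = ∫⁻ ω, f ω ∂((P.withDensity fun ω => ENNReal.ofReal (g ω)).trim hm) :=
        (lintegral_trim hm hf).symm
    _ ≤ ∫⁻ ω, f ω ∂((ENNReal.ofReal c • P).trim hm) := lintegral_mono' hle le_rfl
    _ = ENNReal.ofReal c * ∫⁻ ω, f ω ∂P := by
        rw [lintegral_trim hm hf, lintegral_smul_measure, smul_eq_mul]

/-- The plays of one agent before the horizon and its conditionally 1-sub-Gaussian noise. -/
structure SubGaussianPlays {Ω : Type*} {mΩ : MeasurableSpace Ω} (P : Measure Ω)
    (ℱ : Filtration ℕ mΩ) (T : ℕ) (a : ℕ → Ω → Fin K) (x : ℕ → Ω → ℝ) : Prop where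
  arm_measurable : ∀ t < T, Measurable[ℱ t] (a t)
  noise_measurable : ∀ t < T, Measurable[ℱ (t + 1)] (x t)
  noise_integrable : ∀ t < T, ∀ l : ℝ, Integrable (fun ω => Real.exp (l * x t ω)) P
  noise_subGaussian : ∀ t < T, ∀ l : ℝ,
    P[fun ω => Real.exp (l * x t ω) | ℱ t] ≤ᵐ[P] fun _ => Real.exp (l ^ 2 / 2)

namespace SubGaussianPlays

variable {Ω : Type*} {mΩ : MeasurableSpace Ω} {P : Measure Ω} {ℱ : Filtration ℕ mΩ}
  {T : ℕ} {a : ℕ → Ω → Fin K} {x : ℕ → Ω → ℝ}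

lemma measurable_noiseSum (h : SubGaussianPlays P ℱ T a x) {s t : ℕ} (ht : t ≤ T) (i : Fin K) :
    Measurable[ℱ t] fun ω => noiseSum (fun u => a u ω) (fun u => x u ω) s t i := by
  simp only [noiseSum, Finset.sum_filter]
  refine Finset.measurable_sum _ fun u hu => ?_
  have hu' := (Finset.mem_Ico.1 hu).2
  refine Measurable.ite ?_ ((h.noise_measurable u (by omega)).mono (ℱ.mono (by omega)) le_rfl)
    measurable_const
  exact ((h.arm_measurable u (by omega)).mono (ℱ.mono hu'.le) le_rfl) (measurableSet_singleton i)

lemma measurable_playCount (h : SubGaussianPlays P ℱ T a x) {s t : ℕ} (ht : t ≤ T) (i : Fin K) :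
    Measurable[ℱ t] fun ω => playCount (fun u => a u ω) s t i := by
  simp only [playCount, Finset.card_filter]
  refine Finset.measurable_sum _ fun u hu => ?_
  have hu' := (Finset.mem_Ico.1 hu).2
  refine Measurable.ite ?_ measurable_const measurable_const
  exact ((h.arm_measurable u (by omega)).mono (ℱ.mono hu'.le) le_rfl) (measurableSet_singleton i)

lemma measurable_exponent (h : SubGaussianPlays P ℱ T a x) {s t : ℕ} (ht : t ≤ T) (i : Fin K)
    (l : ℝ) :
    Measurable[ℱ t] fun ω => l * noiseSum (fun u => a u ω) (fun u => x u ω) s t i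
      - l ^ 2 / 2 * (playCount (fun u => a u ω) s t i : ℝ) := by
  have h1 := h.measurable_noiseSum (s := s) ht i
  have h2 := h.measurable_playCount (s := s) ht i
  exact (h1.const_mul l).sub ((measurable_from_nat.comp h2).const_mul _)

/-- The exponential supermartingale of the noise collected from an arm. -/
lemma setLIntegral_exp_le [IsFiniteMeasure P] (h : SubGaussianPlays P ℱ T a x) {s : ℕ} {B : Set Ω}
    (hB : MeasurableSet[ℱ s] B) (i : Fin K) (l : ℝ) {t : ℕ} (hst : s ≤ t) (ht : t ≤ T) :
    ∫⁻ ω in B, ENNReal.ofReal (Real.exp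
      (l * noiseSum (fun u => a u ω) (fun u => x u ω) s t i
        - l ^ 2 / 2 * (playCount (fun u => a u ω) s t i : ℝ))) ∂P ≤ P B := by
  induction t, hst using Nat.le_induction with
  | base => simp [noiseSum_self, playCount_self]
  | succ t hst ih =>
    refine le_trans ?_ (ih (by omega))
    have hBt : MeasurableSet[ℱ t] B := ℱ.mono hst B hB
    set M : Ω → ℝ≥0∞ := fun ω => ENNReal.ofReal (Real.exp
      (l * noiseSum (fun u => a u ω) (fun u => x u ω) s t i
        - l ^ 2 / 2 * (playCount (fun u => a u ω) s t i : ℝ))) with hM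
    have hMm : Measurable[ℱ t] M :=
      (Real.measurable_exp.comp (h.measurable_exponent (by omega) i l)).ennreal_ofReal
    have hE : MeasurableSet[ℱ t] {ω | a t ω = i} :=
      (h.arm_measurable t (by omega)) (measurableSet_singleton i)
    have hE' := ℱ.le t _ hE
    have hB' := ℱ.le t _ hBt
    -- Split by whether arm `i` is played at time `t`, an event of `ℱ t`. If it is, the new factor
    -- has conditional mean at most 1; otherwise nothing changes.
    rw [← lintegral_inter_add_sdiff _ B hE', ← lintegral_inter_add_sdiff M B hE']
    refine add_le_add ?_ (le_of_eq ?_)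
    · calc _ = ∫⁻ ω in B ∩ {ω | a t ω = i}, ENNReal.ofReal (Real.exp (-(l ^ 2 / 2))) *
              (ENNReal.ofReal (Real.exp (l * x t ω)) * M ω) ∂P := by
            refine setLIntegral_congr_fun (hB'.inter hE') fun ω hω => ?_
            have hai : a t ω = i := hω.2
            simp only [hM, noiseSum_succ _ _ hst, playCount_succ _ hst, hai, if_true]
            rw [← ENNReal.ofReal_mul (by positivity), ← ENNReal.ofReal_mul (by positivity),
              ← Real.exp_add, ← Real.exp_add]
            push_cast
            congr 2
            ring
        _ = ENNReal.ofReal (Real.exp (-(l ^ 2 / 2))) * ∫⁻ ω,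
              ENNReal.ofReal (Real.exp (l * x t ω)) *
                (B ∩ {ω | a t ω = i}).indicator M ω ∂P := by
            rw [lintegral_const_mul' _ _ ENNReal.ofReal_ne_top,
              ← lintegral_indicator (hB'.inter hE')]
            congr 2 with ω
            by_cases hω : ω ∈ B ∩ {ω | a t ω = i} <;> simp [hω]
        _ ≤ ENNReal.ofReal (Real.exp (-(l ^ 2 / 2))) * (ENNReal.ofReal (Real.exp (l ^ 2 / 2)) *
              ∫⁻ ω, (B ∩ {ω | a t ω = i}).indicator M ω ∂P) := by
            gcongr
            exact lintegral_mul_ofReal_le_of_condExp_le (ℱ.le t)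
              (hMm.indicator (hBt.inter hE)) (h.noise_integrable t (by omega) l)
              (fun ω => (Real.exp_pos _).le) (h.noise_subGaussian t (by omega) l)
        _ = _ := by
            rw [← mul_assoc, ← ENNReal.ofReal_mul (by positivity), ← Real.exp_add,
              neg_add_cancel, Real.exp_zero, ENNReal.ofReal_one, one_mul,
              lintegral_indicator (hB'.inter hE')]
    · refine setLIntegral_congr_fun (hB'.diff hE') fun ω hω => ?_
      have hai : ¬ a t ω = i := hω.2
      simp only [hM, noiseSum_succ _ _ hst, playCount_succ _ hst, hai, if_false, add_zero]

/-- Chernoff bound. -/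
lemma measure_le_exp_mul [IsFiniteMeasure P] (h : SubGaussianPlays P ℱ T a x) {s : ℕ} {B : Set Ω}
    (hB : MeasurableSet[ℱ s] B) (i : Fin K) (l y : ℝ) {t : ℕ} (hst : s ≤ t) (ht : t ≤ T) :
    P.real (B ∩ {ω | y ≤ l * noiseSum (fun u => a u ω) (fun u => x u ω) s t i
        - l ^ 2 / 2 * (playCount (fun u => a u ω) s t i : ℝ)}) ≤ Real.exp (-y) * P.real B := by
  have hB' := ℱ.le s _ hB
  have hZ := (h.measurable_exponent (s := s) ht i l).mono (ℱ.le t) le_rfl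
  have key : ENNReal.ofReal (Real.exp y) * P (B ∩ {ω | y ≤
      l * noiseSum (fun u => a u ω) (fun u => x u ω) s t i
        - l ^ 2 / 2 * (playCount (fun u => a u ω) s t i : ℝ)}) ≤ P B := by
    refine le_trans ?_ (h.setLIntegral_exp_le hB i l hst ht)
    refine le_trans (le_of_eq ?_) (mul_meas_ge_le_lintegral
      (μ := P.restrict B) (Real.measurable_exp.comp hZ).ennreal_ofReal
      (ENNReal.ofReal (Real.exp y)))
    rw [Measure.restrict_apply' hB', Set.inter_comm]
    congr 2
    ext ω
    simp [ENNReal.ofReal_le_ofReal_iff (Real.exp_pos _).le]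
  have k2 := ENNReal.toReal_mono (measure_ne_top P B) key
  rw [ENNReal.toReal_mul, ENNReal.toReal_ofReal (Real.exp_pos _).le] at k2
  rw [Real.exp_neg, ← div_eq_inv_mul, le_div_iff₀ (Real.exp_pos _), mul_comm]
  exact k2

/-- A geometric grid with ratio `1 + 1 / m` and `m * b` points covers `[1, 2 ^ b)`. -/
lemma exists_grid_point {m b : ℕ} (hm : 1 ≤ m) {y : ℝ} (hy : 1 ≤ y) (hyb : y < 2 ^ b) :
    ∃ k < m * b, |y / (1 + 1 / (m : ℝ)) ^ k - 1| ≤ 1 / m := by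
  have hm0 : (0 : ℝ) < m := by exact_mod_cast hm
  have h1 : (1 : ℝ) < 1 + 1 / (m : ℝ) := by simpa using hm0
  obtain ⟨k, hk1, hk2⟩ := exists_nat_pow_near hy h1
  have hpos : (0 : ℝ) < (1 + 1 / (m : ℝ)) ^ k := by positivity
  refine ⟨k, ?_, ?_⟩
  -- Bernoulli's inequality: `m` grid steps at least double the value, hence `m * b` steps reach `2
  -- ^ b`.
  · have h2 : (2 : ℝ) ≤ (1 + 1 / (m : ℝ)) ^ m := by
      have := one_add_mul_le_pow (a := 1 / (m : ℝ)) (by linarith) m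
      rw [mul_one_div_cancel hm0.ne'] at this
      linarith
    have h3 : (1 + 1 / (m : ℝ)) ^ k < (1 + 1 / (m : ℝ)) ^ (m * b) := by
      rw [pow_mul]
      exact (hk1.trans_lt hyb).trans_le (pow_le_pow_left₀ (by norm_num) h2 b)
    exact (pow_lt_pow_iff_right₀ h1).1 h3
  · have ha : 1 ≤ y / (1 + 1 / (m : ℝ)) ^ k := by rwa [le_div_iff₀ hpos, one_mul]
    have hb : y / (1 + 1 / (m : ℝ)) ^ k ≤ 1 + 1 / m := by
      rw [div_le_iff₀ hpos, mul_comm, ← pow_succ]; exact hk2.le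
    rw [abs_of_nonneg (by linarith)]
    linarith

/-- A large deviation at an unknown sample size is detected by some point of the grid. -/
lemma exists_grid_exponent {m b N : ℕ} (hm : 1 ≤ m) (hN : N ≠ 0) (hNb : N < 2 ^ b) {δ S : ℝ}
    (hδ : 0 ≤ δ) (hδm : δ ≤ m) (hS : Real.sqrt (2 * δ * N) < S) :
    ∃ k < m * b, δ - 1 ≤ Real.sqrt (2 * δ) / (1 + 1 / (m : ℝ)) ^ k * S
      - (Real.sqrt (2 * δ) / (1 + 1 / (m : ℝ)) ^ k) ^ 2 / 2 * N := by
  have hm0 : (1 : ℝ) ≤ m := by exact_mod_cast hm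
  have hN1 : (1 : ℝ) ≤ N := by exact_mod_cast Nat.one_le_iff_ne_zero.2 hN
  have hNs : Real.sqrt N ≤ N := by
    rw [Real.sqrt_le_iff]; exact ⟨by linarith, by nlinarith⟩
  obtain ⟨k, hk, hr⟩ := exists_grid_point hm (Real.one_le_sqrt.2 hN1)
    (hNs.trans_lt (by exact_mod_cast hNb : (N : ℝ) < 2 ^ b))
  refine ⟨k, hk, ?_⟩
  -- The optimal slope `√(2δ / N)` depends on the random `N`, so `√N` is replaced by its grid
  -- approximation `g`. With `r = √N / g` the exponent is at least `2δr - δr² = δ - δ(r - 1)²`, and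
  -- `|r - 1| ≤ 1 / m` with `δ ≤ m` makes the loss at most 1.
  set g : ℝ := (1 + 1 / (m : ℝ)) ^ k with hgdef
  have hg : 0 < g := by positivity
  set r := Real.sqrt N / g with hrdef
  have hl : 0 ≤ Real.sqrt (2 * δ) / g := by positivity
  have e1 : Real.sqrt (2 * δ) / g * Real.sqrt (2 * δ * N) = 2 * δ * r := by
    rw [Real.sqrt_mul (show 0 ≤ 2 * δ by positivity) (N : ℝ), hrdef]
    have := Real.mul_self_sqrt (show 0 ≤ 2 * δ by positivity)
    calc Real.sqrt (2 * δ) / g * (Real.sqrt (2 * δ) * Real.sqrt N)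
        = (Real.sqrt (2 * δ) * Real.sqrt (2 * δ)) * (Real.sqrt N / g) := by ring
      _ = _ := by rw [this]
  have e2 : (Real.sqrt (2 * δ) / g) ^ 2 / 2 * N = δ * r ^ 2 := by
    rw [hrdef, div_pow, div_pow, Real.sq_sqrt (by positivity), Real.sq_sqrt (by positivity)]
    ring
  have e3 : δ * (r - 1) ^ 2 ≤ 1 := by
    have h1 : (r - 1) ^ 2 ≤ (1 / (m : ℝ)) ^ 2 := sq_le_sq.2 (by
      rwa [abs_of_nonneg (show (0 : ℝ) ≤ 1 / m by positivity)])
    calc δ * (r - 1) ^ 2 ≤ (m : ℝ) * (1 / (m : ℝ)) ^ 2 := by gcongr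
      _ = 1 / (m : ℝ) := by field_simp
      _ ≤ 1 := by rw [div_le_one (by linarith)]; exact hm0
  have e4 := mul_le_mul_of_nonneg_left hS.le hl
  rw [e1] at e4
  rw [e2]
  nlinarith

/-- Probability that an arm leaves its confidence interval, uniformly in its number of plays. -/
lemma measureReal_deviates_le [IsFiniteMeasure P] (h : SubGaussianPlays P ℱ T a x) {s : ℕ}
    {B : Set Ω} (hB : MeasurableSet[ℱ s] B) (i : Fin K) {t : ℕ} (hst : s ≤ t) (ht : t < T)
    {m b : ℕ} (hm : 1 ≤ m) (hlm : Real.log T ≤ m) (hb : T < 2 ^ b) :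
    P.real (B ∩ {ω | Deviates (fun u => a u ω) (fun u => x u ω) s t i})
      ≤ 2 * Real.exp 1 * (m * b : ℕ) * P.real B / ((t : ℝ) - s + 1) := by
  set δ := Real.log ((t : ℝ) - s + 1) with hδdef
  have hst' : (s : ℝ) ≤ t := by exact_mod_cast hst
  have hτ : (0 : ℝ) < (t : ℝ) - s + 1 := by linarith
  have hδ : 0 ≤ δ := Real.log_nonneg (by linarith)
  have hδm : δ ≤ m := by
    refine le_trans (Real.log_le_log hτ ?_) hlm
    have : (t : ℝ) + 1 ≤ T := by exact_mod_cast ht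
    linarith [Nat.cast_nonneg (α := ℝ) s]
  set l : ℕ → ℝ := fun k => Real.sqrt (2 * δ) / (1 + 1 / (m : ℝ)) ^ k with hl
  set E : ℝ → Set Ω := fun l => B ∩ {ω | δ - 1 ≤
    l * noiseSum (fun u => a u ω) (fun u => x u ω) s t i
        - l ^ 2 / 2 * (playCount (fun u => a u ω) s t i : ℝ)} with hE
  -- The slopes `l k` and `-l k` catch deviations upwards and downwards.
  have hsub : B ∩ {ω | Deviates (fun u => a u ω) (fun u => x u ω) s t i}
      ⊆ ⋃ k ∈ Finset.range (m * b), (E (l k) ∪ E (-l k)) := by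
    rintro ω ⟨hωB, hN, hS⟩
    have hNb : playCount (fun u => a u ω) s t i < 2 ^ b :=
      lt_of_le_of_lt (playCount_le _ _ _ _) (by omega)
    obtain ⟨k, hk, hk2⟩ := exists_grid_exponent hm hN hNb hδ hδm hS
    simp only [Set.mem_iUnion, Finset.mem_range]
    refine ⟨k, hk, ?_⟩
    rcases abs_cases (noiseSum (fun u => a u ω) (fun u => x u ω) s t i) with ⟨h1, _⟩ | ⟨h1, _⟩
    · rw [h1] at hk2
      exact Or.inl ⟨hωB, hk2⟩
    · rw [h1] at hk2
      refine Or.inr ⟨hωB, ?_⟩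
      simp only [Set.mem_ofPred_eq, hl, neg_sq]
      linarith
  have hexp : Real.exp (-(δ - 1)) = Real.exp 1 / ((t : ℝ) - s + 1) := by
    rw [neg_sub, Real.exp_sub, hδdef, Real.exp_log hτ]
  have hEle : ∀ l, P.real (E l) ≤ Real.exp 1 / ((t : ℝ) - s + 1) * P.real B := fun l => by
    rw [← hexp]
    exact h.measure_le_exp_mul hB i l _ hst ht.le
  calc P.real (B ∩ {ω | Deviates (fun u => a u ω) (fun u => x u ω) s t i})
      ≤ P.real (⋃ k ∈ Finset.range (m * b), (E (l k) ∪ E (-l k))) := measureReal_mono hsub (measure_ne_top P _)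
    _ ≤ ∑ k ∈ Finset.range (m * b), P.real (E (l k) ∪ E (-l k)) :=
        measureReal_biUnion_finset_le _ _
    _ ≤ ∑ _k ∈ Finset.range (m * b), (2 * (Real.exp 1 / ((t : ℝ) - s + 1) * P.real B)) :=
        Finset.sum_le_sum fun k _ => (measureReal_union_le _ _).trans (by
          linarith [hEle (l k), hEle (-l k)])
    _ = _ := by rw [Finset.sum_const, Finset.card_range, nsmul_eq_mul]; ring

lemma measurableSet_deviates (h : SubGaussianPlays P ℱ T a x) {s t : ℕ} (ht : t ≤ T)
    (i : Fin K) :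
    MeasurableSet {ω | Deviates (fun u => a u ω) (fun u => x u ω) s t i} := by
  have h1 := (h.measurable_noiseSum (s := s) ht i).mono (ℱ.le t) le_rfl
  have h2 := (h.measurable_playCount (s := s) ht i).mono (ℱ.le t) le_rfl
  have h3 : Measurable fun ω => (playCount (fun u => a u ω) s t i : ℝ) :=
    measurable_from_nat.comp h2
  refine MeasurableSet.inter ((measurableSet_singleton 0).compl.preimage h2) ?_
  exact measurableSet_lt (h3.const_mul _).sqrt (continuous_abs.measurable.comp h1)

lemma deviations_eq_sum_indicator (A : Ω → Finset (Fin K)) (s t : ℕ) :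
    (fun ω => deviations (A ω) (fun u => a u ω) (fun u => x u ω) s t) = fun ω =>
      ∑ i, ({ω | i ∈ A ω} ∩ {ω | Deviates (fun u => a u ω) (fun u => x u ω) s t i}).indicator
        (1 : Ω → ℝ) ω := by
  classical
  funext ω
  unfold deviations
  refine Finset.sum_congr rfl fun i _ => ?_
  simp [Set.indicator_apply]

variable {A : Ω → Finset (Fin K)} {s : ℕ}

lemma integrable_deviations [IsFiniteMeasure P] (h : SubGaussianPlays P ℱ T a x)
    (hA : ∀ i, MeasurableSet[ℱ s] {ω | i ∈ A ω}) {t : ℕ} (ht : t ≤ T) :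
    Integrable (fun ω => deviations (A ω) (fun u => a u ω) (fun u => x u ω) s t) P := by
  rw [deviations_eq_sum_indicator]
  refine integrable_finsetSum _ fun i _ => (integrable_const 1).indicator ?_
  exact (ℱ.le s _ (hA i)).inter (h.measurableSet_deviates ht i)

/-- The bound for arm `i` carries the factor `P (i ∈ A)`, because this event is known at time `s`.
These probabilities sum to the expected size of `A`, so the bound involves `Q` and not the number
`K` of all arms. -/
lemma integral_deviations_le [IsProbabilityMeasure P] (h : SubGaussianPlays P ℱ T a x)
    (hA : ∀ i, MeasurableSet[ℱ s] {ω | i ∈ A ω}) {Q : ℕ} (hQ : ∀ ω, (A ω).card ≤ Q)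
    {t : ℕ} (hst : s ≤ t) (ht : t < T) {m b : ℕ} (hm : 1 ≤ m) (hlm : Real.log T ≤ m)
    (hb : T < 2 ^ b) :
    ∫ ω, deviations (A ω) (fun u => a u ω) (fun u => x u ω) s t ∂P
      ≤ 2 * Real.exp 1 * (m * b : ℕ) * Q * ((t : ℝ) - s + 1)⁻¹ := by
  have hst' : (s : ℝ) ≤ t := by exact_mod_cast hst
  have hτ : (0 : ℝ) < (t : ℝ) - s + 1 := by linarith
  have hA' : ∀ i, MeasurableSet {ω | i ∈ A ω} := fun i => ℱ.le s _ (hA i)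
  have hm' : ∀ i, MeasurableSet ({ω | i ∈ A ω} ∩
      {ω | Deviates (fun u => a u ω) (fun u => x u ω) s t i}) :=
    fun i => (hA' i).inter (h.measurableSet_deviates ht.le i)
  have hcard : ∑ i, P.real {ω | i ∈ A ω} ≤ Q := by
    calc ∑ i, P.real {ω | i ∈ A ω}
        = ∫ ω, ∑ i, {ω | i ∈ A ω}.indicator (1 : Ω → ℝ) ω ∂P := by
          rw [integral_finsetSum _ fun i _ => (integrable_const 1).indicator (hA' i)]
          exact Finset.sum_congr rfl fun i _ => (integral_indicator_one (hA' i)).symm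
      _ ≤ ∫ _, (Q : ℝ) ∂P := by
          refine integral_mono (integrable_finsetSum _ fun i _ =>
            (integrable_const 1).indicator (hA' i)) (integrable_const _) fun ω => ?_
          have : ∑ i, {ω | i ∈ A ω}.indicator (1 : Ω → ℝ) ω = ((A ω).card : ℝ) := by
            simp [Set.indicator_apply]
          rw [this]
          exact Nat.cast_le.2 (hQ ω)
      _ = Q := by simp
  rw [deviations_eq_sum_indicator, integral_finsetSum _ fun i _ =>
    (integrable_const 1).indicator (hm' i)]
  calc _ = ∑ i, P.real ({ω | i ∈ A ω} ∩
        {ω | Deviates (fun u => a u ω) (fun u => x u ω) s t i}) :=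
        Finset.sum_congr rfl fun i _ => integral_indicator_one (hm' i)
    _ ≤ ∑ i, 2 * Real.exp 1 * (m * b : ℕ) * P.real {ω | i ∈ A ω} / ((t : ℝ) - s + 1) :=
        Finset.sum_le_sum fun i _ => h.measureReal_deviates_le (hA i) i hst ht hm hlm hb
    _ = 2 * Real.exp 1 * (m * b : ℕ) / ((t : ℝ) - s + 1) * ∑ i, P.real {ω | i ∈ A ω} := by
        rw [Finset.mul_sum]; exact Finset.sum_congr rfl fun i _ => by ring
    _ ≤ 2 * Real.exp 1 * (m * b : ℕ) / ((t : ℝ) - s + 1) * Q := by gcongr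
    _ = _ := by ring

end SubGaussianPlays

lemma natLog_two_add_one_le {T : ℕ} (hT : 1 ≤ T) :
    ((Nat.log 2 T + 1 : ℕ) : ℝ) ≤ 2 * (1 + Real.log T) := by
  have h1 : ((2 : ℝ) ^ Nat.log 2 T) ≤ T := by
    exact_mod_cast Nat.pow_log_le_self 2 (by omega)
  have h2 := Real.log_le_log (by positivity) h1
  rw [Real.log_pow] at h2
  have := Real.log_two_gt_d9
  have h0 : (0 : ℝ) ≤ Nat.log 2 T := Nat.cast_nonneg _
  push_cast
  nlinarith

lemma sum_inv_le {s e T : ℕ} (heT : e ≤ T) :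
    ∑ t ∈ Finset.Ico s e, ((t : ℝ) - s + 1)⁻¹ ≤ 1 + Real.log T := by
  rw [Finset.sum_Ico_eq_sum_range]
  calc ∑ k ∈ Finset.range (e - s), (((s + k : ℕ) : ℝ) - s + 1)⁻¹
      = ∑ k ∈ Finset.range (e - s), ((k : ℝ) + 1)⁻¹ := by
        refine Finset.sum_congr rfl fun k _ => ?_
        push_cast; congr 1; ring
    _ ≤ ∑ k ∈ Finset.range T, ((k : ℝ) + 1)⁻¹ :=
        Finset.sum_le_sum_of_subset_of_nonneg (Finset.range_mono (by omega))
          fun k _ _ => by positivity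
    _ = (harmonic T : ℝ) := by simp [harmonic]
    _ ≤ _ := harmonic_le_one_add_log T

/-- Expected number of deviations during an epoch. -/
lemma SubGaussianPlays.integral_sum_deviations_le {Ω : Type*} {mΩ : MeasurableSpace Ω}
    {P : Measure Ω} [IsProbabilityMeasure P] {ℱ : Filtration ℕ mΩ} {T : ℕ}
    {a : ℕ → Ω → Fin K} {x : ℕ → Ω → ℝ} (h : SubGaussianPlays P ℱ T a x)
    {A : Ω → Finset (Fin K)} {s e : ℕ} (hA : ∀ i, MeasurableSet[ℱ s] {ω | i ∈ A ω}) {Q : ℕ}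
    (hQ : ∀ ω, (A ω).card ≤ Q) (hT : 1 ≤ T) (he : e ≤ T) :
    ∫ ω, ∑ t ∈ Finset.Ico s e, deviations (A ω) (fun u => a u ω) (fun u => x u ω) s t ∂P
      ≤ 24 * (1 + Real.log T) ^ 3 * Q := by
  have hL : 0 ≤ Real.log T := Real.log_nonneg (by exact_mod_cast hT)
  set m := ⌈Real.log T⌉₊ + 1 with hm
  set b := Nat.log 2 T + 1 with hb
  have hlm : Real.log T ≤ m := (Nat.le_ceil _).trans (by simp [hm])
  have hm2 : (m : ℝ) ≤ 2 * (1 + Real.log T) := by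
    have := (Nat.ceil_lt_add_one hL).le
    rw [hm]; push_cast; linarith
  have hb2 := natLog_two_add_one_le hT
  rw [← hb] at hb2
  rw [integral_finsetSum _ fun t ht =>
    h.integrable_deviations hA ((Finset.mem_Ico.1 ht).2.le.trans he)]
  calc _ ≤ ∑ t ∈ Finset.Ico s e, 2 * Real.exp 1 * (m * b : ℕ) * Q * ((t : ℝ) - s + 1)⁻¹ :=
        Finset.sum_le_sum fun t ht => h.integral_deviations_le hA hQ (Finset.mem_Ico.1 ht).1
          ((Finset.mem_Ico.1 ht).2.trans_le he) (by omega) hlm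
          (Nat.lt_pow_succ_log_self (by norm_num) T)
    _ = 2 * Real.exp 1 * ((m : ℝ) * b) * Q * ∑ t ∈ Finset.Ico s e, ((t : ℝ) - s + 1)⁻¹ := by
        rw [Finset.mul_sum]; push_cast; rfl
    -- One logarithm each comes from `m`, from `b` and from the harmonic sum; `e < 3`.
    _ ≤ 2 * 3 * ((2 * (1 + Real.log T)) * (2 * (1 + Real.log T))) * Q * (1 + Real.log T) := by
        have := Real.exp_one_lt_three.le
        refine mul_le_mul ?_ (sum_inv_le he) (Finset.sum_nonneg fun t ht => ?_) (by positivity)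
        · gcongr
        · have : (s : ℝ) ≤ t := by exact_mod_cast (Finset.mem_Ico.1 ht).1
          exact inv_nonneg.2 (by linarith)
    _ = _ := by ring

end Concentration

/-! ### Arm sets and epoch lengths -/

section Combinatorics

variable {N K : ℕ}

lemma one_le_armsPerAgent (hN : 1 ≤ N) (hK : 1 ≤ K) : 1 ≤ armsPerAgent N K := by
  unfold armsPerAgent
  rw [Nat.one_le_ceil_iff]
  have : (0 : ℚ) < N := by exact_mod_cast hN
  have : (0 : ℚ) < K := by exact_mod_cast hK
  positivity

lemma le_mul_armsPerAgent (hN : 1 ≤ N) : K ≤ N * armsPerAgent N K := by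
  have h0 : (0 : ℚ) < N := by exact_mod_cast hN
  have h := Nat.le_ceil ((K : ℚ) / (N : ℚ))
  rw [div_le_iff₀ h0, mul_comm] at h
  exact_mod_cast h

/-- Every arm is owned by some agent. -/
lemma exists_mem_initialArms (hN : 1 ≤ N) (i : Fin K) : ∃ n, i ∈ initialArms N K n := by
  have hK : 1 ≤ K := i.pos
  have h1 := one_le_armsPerAgent hN hK
  have h2 : (i : ℕ) < N * armsPerAgent N K := i.2.trans_le (le_mul_armsPerAgent hN)
  refine ⟨⟨(i : ℕ) / armsPerAgent N K, (Nat.div_lt_iff_lt_mul (by omega)).2 h2⟩, ?_⟩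
  simp only [initialArms, Finset.mem_filter, Finset.mem_univ, true_and, Finset.mem_range]
  refine ⟨(i : ℕ) % armsPerAgent N K, Nat.mod_lt _ (by omega), ?_⟩
  rw [Nat.div_add_mod', Nat.mod_eq_of_lt i.2]

lemma card_initialArms_le (n : Fin N) : (initialArms N K n).card ≤ armsPerAgent N K := by
  rw [← Finset.card_map Fin.valEmbedding]
  refine (Finset.card_le_card (t := (Finset.range (armsPerAgent N K)).image
    fun k => ((n : ℕ) * armsPerAgent N K + k) % K) fun v hv => ?_).trans
    (Finset.card_image_le.trans (Finset.card_range _).le)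
  obtain ⟨i, hi, rfl⟩ := Finset.mem_map.1 hv
  obtain ⟨k, hk, hik⟩ := (Finset.mem_filter.1 hi).2
  exact Finset.mem_image.2 ⟨k, hk, hik.symm⟩

variable (G : SimpleGraph (Fin N)) [DecidableRel G.Adj] (msg : Fin N → ℕ → Fin K)

lemma card_augmentedArms_le (n : Fin N) (j : ℕ) :
    (augmentedArms G msg n j).card ≤ effArms K G := by
  cases j with
  | zero => exact (card_initialArms_le n).trans (Nat.le_add_right _ _)
  | succ j =>
    refine (Finset.card_union_le _ _).trans (add_le_add (card_initialArms_le n) ?_)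
    exact Finset.card_image_le.trans (G.degree_le_maxDegree n)

lemma initialArms_subset (n : Fin N) (j : ℕ) : initialArms N K n ⊆ augmentedArms G msg n j := by
  cases j with
  | zero => exact subset_rfl
  | succ j => exact Finset.subset_union_left

lemma msg_mem_augmentedArms {n m : Fin N} (h : G.Adj n m) (j : ℕ) :
    msg m j ∈ augmentedArms G msg n (j + 1) :=
  Finset.mem_union_right _ (Finset.mem_image_of_mem _ ((G.mem_neighborFinset n m).2 h))

lemma one_le_effArms (hN : 1 ≤ N) (hK : 1 ≤ K) : 1 ≤ effArms K G :=
  (one_le_armsPerAgent hN hK).trans (Nat.le_add_right _ _)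

lemma epochStart_succ (K' j : ℕ) :
    epochStart K' (j + 1) = epochStart K' j + epochLength K' j :=
  Finset.sum_range_succ _ _

lemma epochStart_mono (K' : ℕ) : Monotone (epochStart K') :=
  monotone_nat_of_le_succ fun j => by rw [epochStart_succ]; exact Nat.le_add_right _ _

/-- Ensures that `Nat.log 2 T + 1` epochs exhaust the horizon. -/
lemma two_pow_le_epochStart_add_one {K' : ℕ} (hK' : 1 ≤ K') (j : ℕ) :
    2 ^ j ≤ epochStart K' j + 1 := by
  induction j with
  | zero => simp [epochStart]
  | succ j ih =>
    rw [epochStart_succ, pow_succ]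
    have : 1 * 2 ^ j ≤ epochLength K' j :=
      Nat.mul_le_mul_right _ (Nat.one_le_iff_ne_zero.2 (by positivity))
    omega

/-- Any epoch after epoch 0 that starts before `T` thus has full length at most `2 * T`, even if it
is cut off. -/
lemma epochLength_succ_le (K' j : ℕ) : epochLength K' (j + 1) ≤ 2 * epochStart K' (j + 1) := by
  rw [epochStart_succ]
  have : epochLength K' (j + 1) = 2 * epochLength K' j := by
    unfold epochLength; ring
  omega

end Combinatorics

/-! ### Quality of an arm set and its loss per hop -/

/-- Distance of the best mean of an arm of `A` to the best mean. -/
def armSetGap {K : ℕ} (μ : Fin K → ℝ) (A : Finset (Fin K)) : ℝ :=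
  (⨆ i, μ i) - ⨆ i, if i ∈ A then μ i else 0

section Gap

variable {K : ℕ} {μ : Fin K → ℝ} (hμ : ∀ i, 0 ≤ μ i ∧ μ i ≤ 1) (A : Finset (Fin K))

include hμ in
lemma armSetGap_le_one : armSetGap μ A ≤ 1 := by
  have h1 : (⨆ i, μ i) ≤ 1 := Real.iSup_le (fun i => (hμ i).2) zero_le_one
  have h2 : 0 ≤ ⨆ i, if i ∈ A then μ i else 0 :=
    Real.iSup_nonneg fun i => by split_ifs; exacts [(hμ i).1, le_rfl]
  unfold armSetGap
  linarith

include hμ in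
lemma armSetGap_nonneg : 0 ≤ armSetGap μ A := by
  refine sub_nonneg.2 (Real.iSup_le (fun i => ?_) (Real.iSup_nonneg fun i => (hμ i).1))
  refine le_trans ?_ (le_ciSup (Set.finite_range μ).bddAbove i)
  split_ifs
  exacts [le_rfl, (hμ i).1]

variable {A}

lemma armSetGap_le {i : Fin K} (hi : i ∈ A) : armSetGap μ A ≤ (⨆ i, μ i) - μ i := by
  refine sub_le_sub_left (le_of_eq_of_le ?_ (le_ciSup (Set.finite_range _).bddAbove i)) _
  simp [hi]

-- The value 0 given to arms outside `A` is harmless, since all means are nonnegative and `A` is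
-- nonempty.
include hμ in
lemma exists_armSetGap_eq (hA : A.Nonempty) : ∃ i ∈ A, armSetGap μ A = (⨆ i, μ i) - μ i := by
  obtain ⟨i, hi, hmax⟩ := A.exists_max_image μ hA
  refine ⟨i, hi, le_antisymm (armSetGap_le hi) (sub_le_sub_left ?_ _)⟩
  refine Real.iSup_le (fun k => ?_) (hμ i).1
  split_ifs with hk
  exacts [hmax k hk, (hμ i).1]

end Gap

/-- Bound on the expected gap of the arm set in epoch `j` of an agent at distance `d` from an
owner of a best arm; `Λ = 1 + log T` and `k = K'`. -/
def gapBound (Λ : ℝ) (k d j : ℕ) : ℝ :=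
  2 * (2 ^ d - 1) * (1 + 24 * Λ ^ 3) / 2 ^ j
    + 32 * Λ * (Real.sqrt 2 ^ d - 1) / (Real.sqrt k * Real.sqrt 2 ^ j)

lemma gapBound_nonneg {Λ : ℝ} (hΛ : 0 ≤ Λ) (k d j : ℕ) : 0 ≤ gapBound Λ k d j := by
  have h1 : (0 : ℝ) ≤ 2 ^ d - 1 := sub_nonneg.2 (one_le_pow₀ (by norm_num))
  have h2 : (0 : ℝ) ≤ Real.sqrt 2 ^ d - 1 :=
    sub_nonneg.2 (one_le_pow₀ (Real.one_le_sqrt.2 (by norm_num)))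
  unfold gapBound
  positivity

/-- Covers agents that the owner's information has not yet reached, for which only the trivial gap
bound 1 is available. -/
lemma one_le_gapBound_zero {Λ : ℝ} (hΛ : 0 ≤ Λ) (k d : ℕ) : 1 ≤ gapBound Λ k (d + 1) 0 := by
  have h1 : (1 : ℝ) ≤ 2 ^ d := one_le_pow₀ (by norm_num)
  have h2 : (0 : ℝ) ≤ Real.sqrt 2 ^ (d + 1) - 1 :=
    sub_nonneg.2 (one_le_pow₀ (Real.one_le_sqrt.2 (by norm_num)))
  have h3 : 0 ≤ 32 * Λ * (Real.sqrt 2 ^ (d + 1) - 1) / (Real.sqrt k * Real.sqrt 2 ^ 0) := by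
    positivity
  have h4 : 0 ≤ Λ ^ 3 := by positivity
  unfold gapBound
  rw [pow_succ (2 : ℝ), pow_zero, div_one]
  nlinarith

/-- The recursion for one hop. The two terms of `gapBound` come from geometric sums with ratios 2
and `√2` of the losses `(1 + 24 Λ³) / 2 ^ j` and `8 Λ / √(k 2 ^ j)`. -/
lemma gapBound_succ {Λ : ℝ} (hΛ : 0 ≤ Λ) {k : ℕ} (hk : 1 ≤ k) (d j : ℕ) :
    gapBound Λ k d j + (1 + 24 * Λ ^ 3 * k) / (((k : ℝ) + 1) * 2 ^ j)
      + 4 * (2 * Λ) / Real.sqrt (((k : ℝ) + 1) * 2 ^ j) ≤ gapBound Λ k (d + 1) (j + 1) := by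
  have hk0 : (0 : ℝ) < k := by exact_mod_cast hk
  have hx : 1.4 < Real.sqrt 2 := Real.lt_sqrt_of_sq_lt (by norm_num)
  have hxx : Real.sqrt 2 * Real.sqrt 2 = 2 := Real.mul_self_sqrt (by norm_num)
  have hsk := Real.sqrt_pos.2 hk0
  set x := Real.sqrt 2 with hxdef
  have hx0 : 0 < x := by linarith
  have e1 : (1 + 24 * Λ ^ 3 * k) / (((k : ℝ) + 1) * 2 ^ j) ≤ (1 + 24 * Λ ^ 3) / 2 ^ j := by
    rw [div_le_div_iff₀ (by positivity) (by positivity), ← mul_assoc]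
    gcongr
    have : 0 ≤ Λ ^ 3 := by positivity
    nlinarith
  have e2 : 4 * (2 * Λ) / Real.sqrt (((k : ℝ) + 1) * 2 ^ j)
      ≤ 8 * Λ / (Real.sqrt k * x ^ j) := by
    have : Real.sqrt k * x ^ j ≤ Real.sqrt (((k : ℝ) + 1) * 2 ^ j) := by
      apply Real.le_sqrt_of_sq_le
      rw [mul_pow, Real.sq_sqrt hk0.le, ← pow_mul, mul_comm j, pow_mul, pow_two x, hxx]
      gcongr
      linarith
    rw [show 4 * (2 * Λ) = 8 * Λ by ring]
    gcongr
  have e3 : 2 * (2 ^ (d + 1) - 1) * (1 + 24 * Λ ^ 3) / 2 ^ (j + 1)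
      = 2 * (2 ^ d - 1) * (1 + 24 * Λ ^ 3) / 2 ^ j + (1 + 24 * Λ ^ 3) / (2 : ℝ) ^ j := by
    field_simp
    ring
  have e4 : 32 * Λ * (x ^ d - 1) / (Real.sqrt k * x ^ j) + 8 * Λ / (Real.sqrt k * x ^ j)
      ≤ 32 * Λ * (x ^ (d + 1) - 1) / (Real.sqrt k * x ^ (j + 1)) := by
    rw [← add_div, div_le_div_iff₀ (by positivity) (by positivity), pow_succ x d, pow_succ x j]
    -- Amounts to `24 * x ≥ 32`, which `x > 1.4` ensures; this fixes the constant 32.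
    have : (32 * Λ * (x ^ d - 1) + 8 * Λ) * x ≤ 32 * Λ * (x ^ d * x - 1) := by nlinarith
    have h5 := mul_le_mul_of_nonneg_right this (show 0 ≤ Real.sqrt k * x ^ j by positivity)
    linarith
  unfold gapBound
  rw [← hxdef, e3]
  linarith

/-! ### Propagation of good arms along the graph -/

namespace IsLCCUCB

variable {N K : ℕ} {Ω : Type*} {mΩ : MeasurableSpace Ω} {P : Measure Ω}
    {ℱ : Filtration ℕ mΩ} {G : SimpleGraph (Fin N)} [DecidableRel G.Adj] {T : ℕ} {μ : Fin K → ℝ}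
    {η : Fin N → ℕ → Ω → ℝ} {arm msg : Fin N → ℕ → Ω → Fin K}

lemma plays (h : IsLCCUCB P ℱ G T μ η arm msg) (n : Fin N) :
    SubGaussianPlays P ℱ T (arm n) (η n) :=
  ⟨h.arm_measurable n, h.noise_measurable n, h.noise_integrable n, h.noise_subGaussian n⟩

/-- The arm set is random, but known when the epoch starts; the deviation bounds require this. -/
lemma measurableSet_mem_arms (h : IsLCCUCB P ℱ G T μ η arm msg) (n : Fin N) {j : ℕ}
    (hj : epochStart (effArms K G) j ≤ T) (i : Fin K) :
    MeasurableSet[ℱ (epochStart (effArms K G) j)]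
      {ω | i ∈ augmentedArms G (fun n j => msg n j ω) n j} := by
  cases j with
  | zero => exact MeasurableSet.const _
  | succ j =>
    have : {ω | i ∈ augmentedArms G (fun n j => msg n j ω) n (j + 1)}
        = {_ω | i ∈ initialArms N K n} ∪
          ⋃ m ∈ G.neighborFinset n, {ω | msg m j ω = i} := by
      ext ω
      simp [augmentedArms]
    rw [this]
    refine (MeasurableSet.const _).union (Finset.measurableSet_biUnion _ fun m _ => ?_)
    exact h.msg_measurable m j hj (measurableSet_singleton i)

lemma measurable_armSetGap (h : IsLCCUCB P ℱ G T μ η arm msg) (n : Fin N) {j : ℕ}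
    (hj : epochStart (effArms K G) j ≤ T) :
    Measurable fun ω => armSetGap μ (augmentedArms G (fun n j => msg n j ω) n j) := by
  unfold armSetGap
  refine measurable_const.sub (Measurable.iSup fun i => ?_)
  exact Measurable.ite (ℱ.le _ _ (h.measurableSet_mem_arms n hj i)) measurable_const
    measurable_const

lemma integrable_armSetGap [IsFiniteMeasure P] (h : IsLCCUCB P ℱ G T μ η arm msg)
    (hμ : ∀ i, 0 ≤ μ i ∧ μ i ≤ 1) (n : Fin N) {j : ℕ} (hj : epochStart (effArms K G) j ≤ T) :
    Integrable (fun ω => armSetGap μ (augmentedArms G (fun n j => msg n j ω) n j)) P := by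
  refine (integrable_const (1 : ℝ)).mono' (h.measurable_armSetGap n hj).aestronglyMeasurable
    (ae_of_all _ fun ω => ?_)
  rw [Real.norm_of_nonneg (armSetGap_nonneg hμ _)]
  exact armSetGap_le_one hμ _

/-- Number of deviations seen by agent `n` in epoch `j`. -/
def deviationCount (G : SimpleGraph (Fin N)) [DecidableRel G.Adj] (T : ℕ)
    (η : Fin N → ℕ → Ω → ℝ) (arm msg : Fin N → ℕ → Ω → Fin K) (n : Fin N) (j : ℕ) (ω : Ω) : ℝ :=
  ∑ t ∈ Finset.Ico (epochStart (effArms K G) j) (min (epochStart (effArms K G) (j + 1)) T),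
    deviations (augmentedArms G (fun n j => msg n j ω) n j) (fun u => arm n u ω)
      (fun u => η n u ω) (epochStart (effArms K G) j) t

lemma integrable_deviationCount [IsFiniteMeasure P] (h : IsLCCUCB P ℱ G T μ η arm msg)
    (n : Fin N) {j : ℕ} (hj : epochStart (effArms K G) j ≤ T) :
    Integrable (deviationCount G T η arm msg n j) P :=
  integrable_finsetSum _ fun t ht => (h.plays n).integrable_deviations
    (h.measurableSet_mem_arms n hj) (by have := (Finset.mem_Ico.1 ht).2; omega)

lemma integral_deviationCount_le [IsProbabilityMeasure P] (h : IsLCCUCB P ℱ G T μ η arm msg)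
    (n : Fin N) {j : ℕ} (hj : epochStart (effArms K G) j ≤ T) (hT : 1 ≤ T) :
    ∫ ω, deviationCount G T η arm msg n j ω ∂P
      ≤ 24 * (1 + Real.log T) ^ 3 * (effArms K G : ℕ) :=
  (h.plays n).integral_sum_deviations_le (h.measurableSet_mem_arms n hj)
    (fun _ => card_augmentedArms_le G _ n j) hT (min_le_right _ _)

lemma sqrt_two_log_le {s t T : ℕ} (hst : s ≤ t) (ht : t < T) :
    Real.sqrt (2 * Real.log ((t : ℝ) - (s : ℝ) + 1)) ≤ 2 * (1 + Real.log T) := by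
  have hst' : (s : ℝ) ≤ t := by exact_mod_cast hst
  have htT : (t : ℝ) + 1 ≤ T := by exact_mod_cast ht
  have hs : (0 : ℝ) ≤ s := Nat.cast_nonneg s
  have h1 : Real.log ((t : ℝ) - s + 1) ≤ Real.log T :=
    Real.log_le_log (by linarith) (by linarith)
  have h2 : 0 ≤ Real.log T := Real.log_nonneg (by linarith)
  rw [Real.sqrt_le_iff]
  constructor
  · linarith
  · nlinarith

variable (h : IsLCCUCB P ℱ G T μ η arm msg) (hμ : ∀ i, 0 ≤ μ i ∧ μ i ≤ 1)

include h

lemma isUCBPlay (n : Fin N) (j : ℕ) (ω : Ω) :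
    ∀ t ∈ Finset.Ico (epochStart (effArms K G) j) (min (epochStart (effArms K G) (j + 1)) T),
      IsUCBPlay (augmentedArms G (fun n j => msg n j ω) n j) (fun u => arm n u ω)
        (fun u => μ (arm n u ω) + η n u ω) (epochStart (effArms K G) j) t := fun t ht => by
  have := Finset.mem_Ico.1 ht
  exact (h.run ω).play n j t this.1 (by omega) (by omega)

include hμ

/-- The recommendation of a neighbour bounds the gap of the next epoch. -/
lemma armSetGap_succ_le {n m : Fin N} (hnm : G.Adj n m) {j : ℕ}
    (hj : epochStart (effArms K G) (j + 1) ≤ T) (hT : 1 ≤ T) (ω : Ω) :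
    armSetGap μ (augmentedArms G (fun n j => msg n j ω) n (j + 1))
      ≤ armSetGap μ (augmentedArms G (fun n j => msg n j ω) m j)
        + (1 + deviationCount G T η arm msg m j ω) / (((effArms K G : ℕ) + 1 : ℝ) * 2 ^ j)
        + 4 * (2 * (1 + Real.log T)) / Real.sqrt (((effArms K G : ℕ) + 1 : ℝ) * 2 ^ j) := by
  have hL : 0 ≤ Real.log T := Real.log_nonneg (by exact_mod_cast hT)
  have hsend := (h.run ω).send m j hj
  obtain ⟨i, hi, hgap⟩ := exists_armSetGap_eq hμ ⟨_, hsend.1⟩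
  have h1 := armSetGap_le (μ := μ) (msg_mem_augmentedArms G (fun n j => msg n j ω) hnm j)
  have hplay := h.isUCBPlay m j ω
  have hmono := epochStart_mono (effArms K G) (Nat.le_succ j)
  have h2 := IsMostPlayed.gap_le hμ (β := 2 * (1 + Real.log T)) (by positivity)
    (fun t ht => sqrt_two_log_le (Finset.mem_Ico.1 ht).1
      (by have := (Finset.mem_Ico.1 ht).2; omega)) hplay
    (q := ((effArms K G : ℕ) + 1 : ℝ) * 2 ^ j) (by positivity)
    (le_min hmono (hmono.trans hj)) (by
      rw [min_eq_left hj, epochStart_succ, epochLength]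
      have := card_augmentedArms_le G (fun n j => msg n j ω) m j
      have h3 : ((augmentedArms G (fun n j => msg n j ω) m j).card : ℝ) ≤ (effArms K G : ℕ) :=
        Nat.cast_le.2 this
      push_cast
      rw [add_sub_cancel_left]
      calc _ ≤ ((effArms K G : ℕ) + 1 : ℝ) * 2 ^ j * (effArms K G : ℕ) := by gcongr
        _ = _ := by ring)
    (by rw [min_eq_left hj]; exact hsend) hi
  unfold deviationCount
  linarith

variable [IsProbabilityMeasure P]

/-- Induction along the walk: the owner has gap 0 in every epoch, and each edge shifts the epoch by
one and adds the loss of one recommendation. -/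
lemma integral_armSetGap_le {star : Fin K} (hstar : ∀ i, μ i ≤ μ star) (hT : 1 ≤ T)
    {n o : Fin N} (p : G.Walk n o) (ho : star ∈ initialArms N K o) (j : ℕ)
    (hj : epochStart (effArms K G) j ≤ T) :
    ∫ ω, armSetGap μ (augmentedArms G (fun n j => msg n j ω) n j) ∂P
      ≤ gapBound (1 + Real.log T) (effArms K G) p.length j := by
  have hL : 0 ≤ Real.log T := Real.log_nonneg (by exact_mod_cast hT)
  have hk : 1 ≤ effArms K G := one_le_effArms G n.pos star.pos
  induction p generalizing j with
  | nil =>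
    have : Nonempty (Fin K) := ⟨star⟩
    refine (integral_nonpos fun ω => ?_).trans (gapBound_nonneg (by positivity) _ _ _)
    refine (armSetGap_le (initialArms_subset G _ _ j ho)).trans ?_
    exact sub_nonpos.2 (ciSup_le hstar)
  | @cons n m o hnm p ih =>
    cases j with
    | zero =>
      refine le_trans ?_ (one_le_gapBound_zero (by positivity) _ _)
      refine (integral_mono (h.integrable_armSetGap hμ n hj) (integrable_const 1)
        fun ω => armSetGap_le_one hμ _).trans ?_
      simp
    | succ j =>
      have hj' := (epochStart_mono (effArms K G) (Nat.le_succ j)).trans hj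
      refine le_trans ?_ (gapBound_succ (by positivity) hk _ _)
      have i1 := h.integrable_armSetGap hμ m hj'
      have i2 : Integrable (fun ω => (1 + deviationCount G T η arm msg m j ω)
          / (((effArms K G : ℕ) + 1 : ℝ) * 2 ^ j)) P :=
        ((integrable_const (1 : ℝ)).add (h.integrable_deviationCount m hj')).div_const _
      have i3 : Integrable (fun ω => armSetGap μ (augmentedArms G (fun n j => msg n j ω) m j)
          + (1 + deviationCount G T η arm msg m j ω)
            / (((effArms K G : ℕ) + 1 : ℝ) * 2 ^ j)) P := i1.add i2
      refine (integral_mono (h.integrable_armSetGap hμ n hj) (i3.add (integrable_const _))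
        fun ω => h.armSetGap_succ_le hμ hnm hj hT ω).trans ?_
      rw [integral_add' i3 (integrable_const _), integral_add i1 i2, integral_div,
        integral_add (integrable_const _) (h.integrable_deviationCount m hj')]
      simp only [integral_const, probReal_univ, one_smul]
      gcongr
      · exact ih ho j hj'
      · exact h.integral_deviationCount_le m hj' hT

end IsLCCUCB

/-! ### Regret per epoch and summation over epochs -/

lemma epochLength_mul_gapBound_le {Λ : ℝ} (hΛ : 0 ≤ Λ) {k d D : ℕ} (hk : 1 ≤ k) (hd : d ≤ D)
    (j : ℕ) {T : ℝ} (hLT : (epochLength k j : ℝ) ≤ 2 * T) :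
    (epochLength k j : ℝ) * gapBound Λ k d j ≤
      4 * (1 + 24 * Λ ^ 3) * (2 ^ D * (k : ℝ) ^ 2) + 64 * Λ * Real.sqrt (2 ^ D * k * T) := by
  have hk1 : (1 : ℝ) ≤ k := by exact_mod_cast hk
  have hk0 : (0 : ℝ) < k := by linarith
  have hT : 0 ≤ T := by linarith [Nat.cast_nonneg (α := ℝ) (epochLength k j)]
  have hx1 : 1 ≤ Real.sqrt 2 := Real.one_le_sqrt.2 (by norm_num)
  have hpow : ∀ n : ℕ, Real.sqrt 2 ^ n = Real.sqrt (2 ^ n) := fun n => by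
    induction n with
    | zero => simp
    | succ n ih => rw [pow_succ, pow_succ, Real.sqrt_mul (by positivity), ih]
  have hLeq : (epochLength k j : ℝ) = k * (k + 1) * 2 ^ j := by simp [epochLength]
  have e1 : (epochLength k j : ℝ) * (2 * (2 ^ d - 1) * (1 + 24 * Λ ^ 3) / 2 ^ j)
      ≤ 4 * (1 + 24 * Λ ^ 3) * (2 ^ D * (k : ℝ) ^ 2) := by
    have h2 : (2 : ℝ) ^ d - 1 ≤ 2 ^ D := by
      linarith [pow_le_pow_right₀ (one_le_two : (1 : ℝ) ≤ 2) hd]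
    have h2' : (0 : ℝ) ≤ 2 ^ d - 1 := sub_nonneg.2 (one_le_pow₀ (by norm_num))
    calc (epochLength k j : ℝ) * (2 * (2 ^ d - 1) * (1 + 24 * Λ ^ 3) / 2 ^ j)
        = k * (k + 1) * (2 * (1 + 24 * Λ ^ 3)) * (2 ^ d - 1) := by
          rw [hLeq]; field_simp
      _ ≤ k * (k + k) * (2 * (1 + 24 * Λ ^ 3)) * 2 ^ D := by gcongr
      _ = _ := by ring
  have e2 : (epochLength k j : ℝ) * (32 * Λ * (Real.sqrt 2 ^ d - 1)
        / (Real.sqrt k * Real.sqrt 2 ^ j)) ≤ 64 * Λ * Real.sqrt (2 ^ D * k * T) := by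
    have h2 : Real.sqrt 2 ^ d - 1 ≤ Real.sqrt 2 ^ D := by
      linarith [pow_le_pow_right₀ hx1 hd]
    have h3 : (epochLength k j : ℝ) / (Real.sqrt k * Real.sqrt 2 ^ j)
        ≤ 2 * Real.sqrt (k * T) := by
      have hs : Real.sqrt k * Real.sqrt 2 ^ j = Real.sqrt (k * 2 ^ j) := by
        rw [hpow, Real.sqrt_mul hk0.le]
      have h4 : 0 < Real.sqrt (k * 2 ^ j) := Real.sqrt_pos.2 (by positivity)
      rw [hs, div_le_iff₀ h4, mul_assoc, ← Real.sqrt_mul (by positivity)]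
      have h5 : (epochLength k j : ℝ) / 2 ≤ Real.sqrt (k * T * (k * 2 ^ j)) := by
        apply Real.le_sqrt_of_sq_le
        -- One factor of the squared length is bounded by `2 * T`, the other by `2 * k ^ 2 * 2 ^ j`.
        calc ((epochLength k j : ℝ) / 2) ^ 2
            = (epochLength k j : ℝ) * (k * (k + 1) * 2 ^ j) / 4 := by rw [← hLeq]; ring
          _ ≤ (2 * T) * (k * (k + k) * 2 ^ j) / 4 := by gcongr
          _ = _ := by ring
      linarith
    calc (epochLength k j : ℝ) * (32 * Λ * (Real.sqrt 2 ^ d - 1)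
          / (Real.sqrt k * Real.sqrt 2 ^ j))
        = 32 * Λ * (Real.sqrt 2 ^ d - 1)
          * ((epochLength k j : ℝ) / (Real.sqrt k * Real.sqrt 2 ^ j)) := by ring
      _ ≤ 32 * Λ * Real.sqrt 2 ^ D * (2 * Real.sqrt (k * T)) := by gcongr
      _ = _ := by
          rw [hpow, mul_assoc (2 ^ D : ℝ),
            Real.sqrt_mul (show (0 : ℝ) ≤ 2 ^ D by positivity) (k * T)]
          ring
  unfold gapBound
  rw [mul_add]
  exact add_le_add e1 e2

lemma epochRegret_bound_le {Λ : ℝ} (hΛ : 1 ≤ Λ) {k d D : ℕ} (hk : 1 ≤ k) (hd : d ≤ D) (j : ℕ)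
    {l T : ℝ} (hlL : l ≤ epochLength k j) (hlT : l ≤ T)
    (hLT : (epochLength k j : ℝ) ≤ 2 * T) :
    l * gapBound Λ k d j + (k + 4 * (2 * Λ) * Real.sqrt (k * l)) + 24 * Λ ^ 3 * k ≤
      125 * Λ ^ 3 * (2 ^ D * (k : ℝ) ^ 2) + 80 * Λ * Real.sqrt (2 ^ D * k * T) := by
  have hΛ0 : 0 ≤ Λ := by linarith
  have hk1 : (1 : ℝ) ≤ k := by exact_mod_cast hk
  have h1 : l * gapBound Λ k d j ≤ (epochLength k j : ℝ) * gapBound Λ k d j :=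
    mul_le_mul_of_nonneg_right hlL (gapBound_nonneg hΛ0 k d j)
  have h2 := epochLength_mul_gapBound_le hΛ0 hk hd j hLT
  have hT : 0 ≤ T := by linarith [Nat.cast_nonneg (α := ℝ) (epochLength k j)]
  have h2D : (1 : ℝ) ≤ 2 ^ D := one_le_pow₀ (by norm_num)
  have h3 : Real.sqrt (k * l) ≤ Real.sqrt (2 ^ D * k * T) := by
    apply Real.sqrt_le_sqrt
    calc (k : ℝ) * l ≤ 1 * k * T := by rw [one_mul]; gcongr
      _ ≤ 2 ^ D * k * T := by gcongr
  have h4 : (k : ℝ) ≤ 2 ^ D * (k : ℝ) ^ 2 := by nlinarith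
  have h5 : 1 ≤ Λ ^ 3 := one_le_pow₀ hΛ
  have h6 := Real.sqrt_nonneg (2 ^ D * k * T)
  have h7 : 4 * (2 * Λ) * Real.sqrt (k * l) ≤ 8 * Λ * Real.sqrt (2 ^ D * k * T) := by
    rw [show 4 * (2 * Λ) = 8 * Λ by ring]; gcongr
  have h8 : 0 ≤ Λ * Real.sqrt (2 ^ D * k * T) := by positivity
  have h9 : 24 * Λ ^ 3 * k ≤ 24 * Λ ^ 3 * (2 ^ D * (k : ℝ) ^ 2) := by gcongr
  have h10 : 2 ^ D * (k : ℝ) ^ 2 ≤ Λ ^ 3 * (2 ^ D * (k : ℝ) ^ 2) :=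
    le_mul_of_one_le_left (by positivity) h5
  -- The constants: `4 (1 + 24 Λ³) + 1 + 24 Λ³ ≤ 125 Λ³` and `64 + 8 ≤ 80`.
  linarith

lemma sum_range_epochs {M : Type*} [AddCommMonoid M] (f : ℕ → M) (k T : ℕ) {b : ℕ}
    (hb : T ≤ epochStart k b) :
    ∑ t ∈ Finset.range T, f t = ∑ j ∈ Finset.range b,
      ∑ t ∈ Finset.Ico (epochStart k j) (min (epochStart k (j + 1)) T), f t := by
  suffices H : ∀ b, ∑ t ∈ Finset.range (min (epochStart k b) T), f t
      = ∑ j ∈ Finset.range b,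
        ∑ t ∈ Finset.Ico (epochStart k j) (min (epochStart k (j + 1)) T), f t by
    rw [← H, min_eq_right hb]
  intro b
  induction b with
  | zero => simp [epochStart]
  | succ b ih =>
    have hmono := epochStart_mono k (Nat.le_succ b)
    rw [Finset.sum_range_succ, ← ih]
    rcases le_total (epochStart k b) T with hT | hT
    · rw [min_eq_left hT, Finset.range_eq_Ico, Finset.range_eq_Ico,
        Finset.sum_Ico_consecutive _ (Nat.zero_le _) (le_min hmono hT)]
    · rw [min_eq_right hT, min_eq_right (hT.trans hmono), Finset.Ico_eq_empty_of_le hT,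
        Finset.sum_empty, add_zero]

namespace IsLCCUCB

variable {N K : ℕ} {Ω : Type*} {mΩ : MeasurableSpace Ω} {P : Measure Ω}
    {ℱ : Filtration ℕ mΩ} {G : SimpleGraph (Fin N)} [DecidableRel G.Adj] {T : ℕ} {μ : Fin K → ℝ}
    {η : Fin N → ℕ → Ω → ℝ} {arm msg : Fin N → ℕ → Ω → Fin K}
    (h : IsLCCUCB P ℱ G T μ η arm msg) (hμ : ∀ i, 0 ≤ μ i ∧ μ i ≤ 1)

include h hμ

lemma integrable_mean_arm [IsFiniteMeasure P] (n : Fin N) {t : ℕ} (ht : t < T) :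
    Integrable (fun ω => μ (arm n t ω)) P := by
  have hm : Measurable fun ω => μ (arm n t ω) :=
    (measurable_of_countable μ).comp ((h.arm_measurable n t ht).mono (ℱ.le t) le_rfl)
  refine (integrable_const (1 : ℝ)).mono' hm.aestronglyMeasurable (ae_of_all _ fun ω => ?_)
  rw [Real.norm_of_nonneg (hμ _).1]
  exact (hμ _).2

/-- Regret of an agent in one epoch, in terms of the gap of its arm set. -/
lemma epochRegret_le (n : Fin N) (j : ℕ) (hj : epochStart (effArms K G) j < T) (ω : Ω) :
    ∑ t ∈ Finset.Ico (epochStart (effArms K G) j) (min (epochStart (effArms K G) (j + 1)) T),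
        ((⨆ i, μ i) - μ (arm n t ω)) ≤
      ((min (epochStart (effArms K G) (j + 1)) T : ℕ) - (epochStart (effArms K G) j : ℝ))
          * armSetGap μ (augmentedArms G (fun n j => msg n j ω) n j)
        + ((effArms K G : ℕ) + 4 * (2 * (1 + Real.log T)) * Real.sqrt ((effArms K G : ℕ) *
          ((min (epochStart (effArms K G) (j + 1)) T : ℕ) - (epochStart (effArms K G) j : ℝ))))
        + deviationCount G T η arm msg n j ω := by
  set k := effArms K G with hk
  set s := epochStart k j with hs
  set e := min (epochStart k (j + 1)) T with he
  have hse : s ≤ e := le_min (epochStart_mono k (Nat.le_succ j)) hj.le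
  have hse' : (0 : ℝ) ≤ (e : ℝ) - s := sub_nonneg.2 (Nat.cast_le.2 hse)
  have hL : 0 ≤ Real.log T := Real.log_nonneg (by exact_mod_cast (by omega : 1 ≤ T))
  have hpos : 1 ≤ k := one_le_effArms G n.pos (arm n 0 ω).pos
  have hlt : s < epochStart k (j + 1) := by
    rw [epochStart_succ]
    exact Nat.lt_add_of_pos_right (by unfold epochLength; positivity)
  have hplay := h.isUCBPlay n j ω
  -- The first play of the epoch witnesses that the arm set is nonempty.
  obtain ⟨i, hi, hgap⟩ := exists_armSetGap_eq hμ
    ⟨_, (hplay s (Finset.mem_Ico.2 ⟨le_rfl, lt_min hlt hj⟩)).1⟩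
  have h1 := sum_gap_le hμ (β := 2 * (1 + Real.log T)) (by positivity)
    (fun t ht => sqrt_two_log_le (Finset.mem_Ico.1 ht).1
      (by have := (Finset.mem_Ico.1 ht).2; omega)) hplay hse hi
  have hcard : ((augmentedArms G (fun n j => msg n j ω) n j).card : ℝ) ≤ (k : ℕ) :=
    Nat.cast_le.2 (card_augmentedArms_le G _ n j)
  have h2 : ∑ t ∈ Finset.Ico s e, ((⨆ i, μ i) - μ (arm n t ω))
      = ((e : ℝ) - s) * armSetGap μ (augmentedArms G (fun n j => msg n j ω) n j)
        + ∑ t ∈ Finset.Ico s e, (μ i - μ (arm n t ω)) := by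
    rw [hgap, ← Nat.cast_sub hse, ← Nat.card_Ico, ← nsmul_eq_mul, ← Finset.sum_const,
      ← Finset.sum_add_distrib]
    exact Finset.sum_congr rfl fun t _ => by ring
  rw [h2, add_assoc, add_assoc]
  refine add_le_add le_rfl (h1.trans ?_)
  rw [add_assoc]
  unfold deviationCount
  gcongr

variable [IsProbabilityMeasure P]

/-- Epoch 0 is treated apart, since its full length need not be bounded by `2 * T`; its at most `K'
(K' + 1) ≤ 2 K' ^ 2` steps cost at most 1 each. Later epochs use a shortest walk to an owner of a
best arm. -/
lemma integral_epochRegret_le {star : Fin K} (hstar : ∀ i, μ i ≤ μ star) (hG : G.Connected)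
    (n : Fin N) (j : ℕ) (hj : epochStart (effArms K G) j < T) :
    ∫ ω, ∑ t ∈ Finset.Ico (epochStart (effArms K G) j)
        (min (epochStart (effArms K G) (j + 1)) T), ((⨆ i, μ i) - μ (arm n t ω)) ∂P ≤
      125 * (1 + Real.log T) ^ 3 * (2 ^ G.diam * ((effArms K G : ℕ) : ℝ) ^ 2)
        + 80 * (1 + Real.log T) * Real.sqrt (2 ^ G.diam * (effArms K G : ℕ) * T) := by
  have hT : 1 ≤ T := by omega
  have hL : 0 ≤ Real.log T := Real.log_nonneg (by exact_mod_cast hT)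
  have hk : 1 ≤ effArms K G := one_le_effArms G n.pos star.pos
  have hk1 : (1 : ℝ) ≤ (effArms K G : ℕ) := by exact_mod_cast hk
  have hse : epochStart (effArms K G) j ≤ min (epochStart (effArms K G) (j + 1)) T :=
    le_min (epochStart_mono _ (Nat.le_succ j)) hj.le
  have hint : Integrable (fun ω => ∑ t ∈ Finset.Ico (epochStart (effArms K G) j)
      (min (epochStart (effArms K G) (j + 1)) T), ((⨆ i, μ i) - μ (arm n t ω))) P :=
    integrable_finsetSum _ fun t ht => (integrable_const _).sub
      (h.integrable_mean_arm hμ n (by have := (Finset.mem_Ico.1 ht).2; omega))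
  set l : ℝ := (min (epochStart (effArms K G) (j + 1)) T : ℕ)
    - (epochStart (effArms K G) j : ℝ) with hl
  have hlT : l ≤ T := by
    have h1 : ((min (epochStart (effArms K G) (j + 1)) T : ℕ) : ℝ) ≤ T :=
      Nat.cast_le.2 (min_le_right _ _)
    linarith [Nat.cast_nonneg (α := ℝ) (epochStart (effArms K G) j)]
  have hlL : l ≤ epochLength (effArms K G) j := by
    have h1 : ((min (epochStart (effArms K G) (j + 1)) T : ℕ) : ℝ)
        ≤ (epochStart (effArms K G) (j + 1) : ℕ) := Nat.cast_le.2 (min_le_left _ _)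
    have h2 : ((epochStart (effArms K G) (j + 1) : ℕ) : ℝ)
        = epochStart (effArms K G) j + epochLength (effArms K G) j := by
      rw [epochStart_succ, Nat.cast_add]
    linarith
  cases j with
  | zero =>
    have hle : ∀ ω, ∑ t ∈ Finset.Ico (epochStart (effArms K G) 0)
        (min (epochStart (effArms K G) (0 + 1)) T), ((⨆ i, μ i) - μ (arm n t ω)) ≤ l := fun ω => by
      have h1 : (⨆ i, μ i) ≤ 1 := Real.iSup_le (fun i => (hμ i).2) zero_le_one
      refine (Finset.sum_le_card_nsmul _ _ 1 fun t _ => by linarith [(hμ (arm n t ω)).1]).trans ?_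
      rw [Nat.card_Ico, nsmul_eq_mul, mul_one, Nat.cast_sub hse]
    refine (integral_mono hint (integrable_const l) hle).trans ?_
    simp only [integral_const, probReal_univ, one_smul]
    have h1 : (epochLength (effArms K G) 0 : ℝ)
        = (effArms K G : ℕ) * ((effArms K G : ℕ) + 1) := by simp [epochLength]
    have h2 : (1 : ℝ) ≤ 2 ^ G.diam := one_le_pow₀ (by norm_num)
    have h3 : (1 : ℝ) ≤ (1 + Real.log T) ^ 3 := one_le_pow₀ (by linarith)
    have h4 : 0 ≤ 80 * (1 + Real.log T)
      * Real.sqrt (2 ^ G.diam * (effArms K G : ℕ) * T) := by positivity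
    have h5 : (1 : ℝ) * (1 * ((effArms K G : ℕ) : ℝ) ^ 2)
        ≤ (1 + Real.log T) ^ 3 * (2 ^ G.diam * ((effArms K G : ℕ) : ℝ) ^ 2) := by gcongr
    nlinarith
  | succ j =>
    obtain ⟨o, ho⟩ := exists_mem_initialArms (N := N) n.pos star
    obtain ⟨p, hp⟩ := hG.exists_walk_length_eq_dist n o
    have hpD : p.length ≤ G.diam := by
      rw [hp]
      have : Nonempty (Fin N) := ⟨n⟩
      exact SimpleGraph.dist_le_diam (SimpleGraph.connected_iff_ediam_ne_top.1 hG)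
    have hgap := h.integral_armSetGap_le hμ hstar hT p ho (j + 1) hj.le
    have hdev := h.integral_deviationCount_le n hj.le hT
    have hLT : (epochLength (effArms K G) (j + 1) : ℝ) ≤ 2 * T := by
      have h1 := epochLength_succ_le (effArms K G) j
      exact_mod_cast h1.trans (Nat.mul_le_mul_left 2 hj.le)
    have i1 := (h.integrable_armSetGap hμ n hj.le).const_mul l
    have i2 := h.integrable_deviationCount n hj.le
    have hmain := integral_mono hint ((i1.add (integrable_const _)).add i2)
      (h.epochRegret_le hμ n (j + 1) hj)
    refine le_trans ?_ (epochRegret_bound_le (by linarith) hk hpD (j + 1) hlL hlT hLT)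
    refine hmain.trans ?_
    rw [integral_add' (i1.add (integrable_const _)) i2, integral_add' i1 (integrable_const _),
      integral_const_mul]
    simp only [integral_const, probReal_univ, one_smul]
    have hl0 : 0 ≤ l := sub_nonneg.2 (Nat.cast_le.2 hse)
    gcongr

lemma regret_le {star : Fin K} (hstar : ∀ i, μ i ≤ μ star) (hG : G.Connected) (hN : 2 ≤ N)
    (hT : 1 ≤ T) (n : Fin N) :
    regret P μ T (arm n) ≤ 250 * (1 + Real.log T) ^ 4 *
      (2 ^ G.diam * ((effArms K G : ℕ) : ℝ) ^ 2
        + Real.sqrt (G.diam * 2 ^ G.diam * (effArms K G : ℕ) * T)) := by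
  have hL : 0 ≤ Real.log T := Real.log_nonneg (by exact_mod_cast hT)
  have hk : 1 ≤ effArms K G := one_le_effArms G n.pos star.pos
  set b := Nat.log 2 T + 1 with hb
  have hb2 := natLog_two_add_one_le hT
  rw [← hb] at hb2
  have hTb : T ≤ epochStart (effArms K G) b := by
    have h1 := two_pow_le_epochStart_add_one hk b
    have h2 : T < 2 ^ b := Nat.lt_pow_succ_log_self (by norm_num) T
    omega
  -- With two or more agents the diameter is positive, so the factor `D` under the root can be
  -- inserted; the epoch bounds hold without it.
  have hD : (1 : ℝ) ≤ G.diam := by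
    have : Nonempty (Fin N) := ⟨n⟩
    have : Nontrivial (Fin N) := Fin.nontrivial_iff_two_le.2 hN
    have h1 : G.diam ≠ 0 := fun h0 => by
      rcases SimpleGraph.diam_eq_zero.1 h0 with h2 | h2
      · exact SimpleGraph.connected_iff_ediam_ne_top.1 hG h2
      · exact not_subsingleton _ h2
    exact_mod_cast Nat.one_le_iff_ne_zero.2 h1
  set X : ℝ := 2 ^ G.diam * ((effArms K G : ℕ) : ℝ) ^ 2 with hX
  set Y : ℝ := Real.sqrt (G.diam * 2 ^ G.diam * (effArms K G : ℕ) * T) with hY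
  set Λ : ℝ := 1 + Real.log T with hΛ
  have hΛ1 : 1 ≤ Λ := by linarith
  have hX0 : 0 ≤ X := by positivity
  have hY0 : 0 ≤ Y := Real.sqrt_nonneg _
  have hYY : Real.sqrt (2 ^ G.diam * (effArms K G : ℕ) * T) ≤ Y := by
    apply Real.sqrt_le_sqrt
    rw [mul_assoc (G.diam : ℝ), mul_assoc (G.diam : ℝ)]
    exact le_mul_of_one_le_left (by positivity) hD
  have hint : ∀ t ∈ Finset.range T, Integrable (fun ω => (⨆ i, μ i) - μ (arm n t ω)) P :=
    fun t ht => (integrable_const _).sub (h.integrable_mean_arm hμ n (Finset.mem_range.1 ht))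
  have hint' : ∀ j ∈ Finset.range b, Integrable (fun ω =>
      ∑ t ∈ Finset.Ico (epochStart (effArms K G) j)
        (min (epochStart (effArms K G) (j + 1)) T), ((⨆ i, μ i) - μ (arm n t ω))) P :=
    fun j _ => integrable_finsetSum _ fun t ht => hint t (Finset.mem_range.2 (by
      have := (Finset.mem_Ico.1 ht).2; omega))
  have hreg : regret P μ T (arm n)
      = ∫ ω, ∑ t ∈ Finset.range T, ((⨆ i, μ i) - μ (arm n t ω)) ∂P := by
    unfold regret
    simp only [Finset.sum_sub_distrib, Finset.sum_const, Finset.card_range, nsmul_eq_mul]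
    rw [integral_sub (integrable_const _) (integrable_finsetSum _ fun t ht =>
      h.integrable_mean_arm hμ n (Finset.mem_range.1 ht))]
    simp
  have hepoch : ∀ j, ∫ ω, ∑ t ∈ Finset.Ico (epochStart (effArms K G) j)
        (min (epochStart (effArms K G) (j + 1)) T), ((⨆ i, μ i) - μ (arm n t ω)) ∂P
      ≤ 125 * Λ ^ 3 * (X + Y) := fun j => by
    rcases lt_or_ge (epochStart (effArms K G) j) T with hj | hj
    · refine (h.integral_epochRegret_le hμ hstar hG n j hj).trans ?_
      have h1 : Λ ≤ Λ ^ 3 := le_self_pow₀ hΛ1 (by norm_num)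
      have h2 : 80 * Λ * Real.sqrt (2 ^ G.diam * (effArms K G : ℕ) * T) ≤ 125 * Λ ^ 3 * Y := by
        gcongr
        norm_num
      linarith
    · rw [Finset.Ico_eq_empty_of_le ((min_le_right _ _).trans hj)]
      simp only [Finset.sum_empty, integral_zero]
      positivity
  rw [hreg]
  simp only [sum_range_epochs (fun t => (⨆ i, μ i) - μ (arm n t _)) (effArms K G) T hTb]
  rw [integral_finsetSum _ hint']
  calc _ ≤ ∑ _j ∈ Finset.range b, 125 * Λ ^ 3 * (X + Y) := Finset.sum_le_sum fun j _ => hepoch j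
    _ = b * (125 * Λ ^ 3 * (X + Y)) := by rw [Finset.sum_const, Finset.card_range, nsmul_eq_mul]
    -- At most `2 * Λ` epochs: this gives the constant 250 and the power 4.
    _ ≤ 2 * Λ * (125 * Λ ^ 3 * (X + Y)) := by gcongr
    _ = _ := by ring

end IsLCCUCB

end LCCUCB

end

theorem mainTheorem3 :
    ∃ (C : ℝ) (p : ℕ), 0 < C ∧
      ∀ (N K T : ℕ) (G : SimpleGraph (Fin N)) [DecidableRel G.Adj] (μ : Fin K → ℝ)
        (Ω : Type*) [mΩ : MeasurableSpace Ω] (P : Measure Ω) [IsProbabilityMeasure P]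
        (ℱ : Filtration ℕ mΩ) (η : Fin N → ℕ → Ω → ℝ) (arm msg : Fin N → ℕ → Ω → Fin K),
        2 ≤ N → 1 ≤ K → G.Connected → (∀ i, 0 ≤ μ i ∧ μ i ≤ 1) →
        LCCUCB.IsLCCUCB P ℱ G T μ η arm msg →
        ∀ n : Fin N,
          LCCUCB.regret P μ T (arm n) ≤
            C * (1 + Real.log (T : ℝ)) ^ p *
              ((2 : ℝ) ^ G.diam * (LCCUCB.effArms K G : ℝ) ^ 2 +
                Real.sqrt ((G.diam : ℝ) * (2 : ℝ) ^ G.diam * (LCCUCB.effArms K G : ℝ) * (T : ℝ))) := by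
  refine ⟨250, 4, by norm_num, ?_⟩
  intro N K T G _ μ Ω _ P _ ℱ η arm msg hN hK hG hμ h n
  have : Nonempty (Fin K) := ⟨⟨0, hK⟩⟩
  obtain ⟨star, hstar⟩ := Finite.exists_max μ
  rcases Nat.eq_zero_or_pos T with rfl | hT
  -- At horizon 0 the regret vanishes, and the convention `Real.log 0 = 0` keeps the bound
  -- nonnegative.
  · simp only [LCCUCB.regret, Finset.range_zero, Finset.sum_empty, integral_zero, Nat.cast_zero,
      zero_mul, sub_zero, Real.log_zero]
    positivity
  · exact h.regret_le hμ hstar hG hN hT n
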